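/- Let $k$ be a field of characteristic $0$, $\beta\in k$, and $0\le m\le N$ integers. Let $z_1,\dots,z_N$ be commuting and $\theta_1,\dots,\theta_N$ anticommuting variables ($z_i\theta_j=\theta_jz_i$, $\theta_i\theta_j=-\theta_j\theta_i$), put $\partial_i=\partial/\partial z_i$ and let $\partial_{\theta_i}$ be the left Grassmann derivative. On the superfunctions that are rational in $z$ consider the operator $$\bar{\mathcal H}=\sum_i(z_i\partial_i)^2+\beta\sum_{i<j}\frac{z_i+z_j}{z_i-z_j}(z_i\partial_i-z_j\partial_j)-2\beta\sum_{i<j}\frac{z_iz_j}{(z_i-z_j)^2}(1-\kappa_{ij}),\qquad \kappa_{ij}=1-(\theta_i-\theta_j)(\partial_{\theta_i}-\partial_{\theta_j}).$$ A superpartition is a sequence of non-negative integers $\Lambda=(\Lambda_1,\dots,\Lambda_m;\Lambda_{m+1},\dots,\Lambda_N)$ with $\Lambda_1>\dots>\Lambda_m$ and $\Lambda_{m+1}\ge\dots\ge\Lambda_N$. Let $n_{\Lambda}(a)$ be the number of $j>m$ with $\Lambda_j=a$, let $\Lambda^*$ be the decreasing rearrangement of all the parts of $\Lambda$, and set $$m_\Lambda=\frac1{\prod_{a\ge0}n_\Lambda(a)!}\sum_{\sigma\in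 S_N}\theta_{\sigma(1)}\cdots\theta_{\sigma(m)}\,z_{\sigma(1)}^{\Lambda_1}\cdots z_{\sigma(N)}^{\Lambda_N},\qquad \varepsilon_\Lambda=\sum_{j=1}^N\big[(\Lambda^*_j)^2+\beta(N+1-2j)\Lambda_j^*\big].$$ For $i<j$ and an integer $\ell\ge0$, let $R^{(\ell)}_{ij}\Lambda$ be the sequence obtained from $\Lambda$ by lowering the larger of $\Lambda_i,\Lambda_j$ by $\ell$ and raising the smaller one by $\ell$. It is defined only if: $\ell\le\lfloor(\Lambda_i-\Lambda_j-1)/2\rfloor$ when $j\le m$ (type I); $\ell\le|\Lambda_i-\Lambda_j|-1$ when $i\le m<j$ (type II); $\ell\le\lfloor(\Lambda_i-\Lambda_j)/2\rfloor$ when $m<i$ (type III). For a sequence $\gamma$ whose first $m$ entries are distinct let $\overline\gamma$ be the superpartition obtained by sorting in decreasing order the first $m$ entries and, separately, the last $N-m$ entries, and let $\operatorname{sgn}(\sigma^a_\gamma)$ be the sign of the permutation that sorts the first $m$ entries. Write $\Omega\le^s\Lambda$ if $\Omega$ is obtained from $\Lambda$ by a finite (possibly empty) sequence of operations $\Gamma\mapsto\overline{R^{(\ell)}_{ij}\Gamma}$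 between superpartitions, and $\Omega<^s\Lambda$ if moreover $\Omega\ne\Lambda$. Then the action of $\bar{\mathcal H}$ on the supermonomials $m_\Lambda$ is triangular: for every $\Lambda$ there are only finitely many $\Omega<^s\Lambda$, and $$\bar{\mathcal H}\,m_\Lambda=\varepsilon_\Lambda m_\Lambda+\sum_{\Omega<^s\Lambda}v_{\Lambda\Omega}(\beta)\,m_\Omega .$$ Here $v_{\Lambda\Omega}(\beta)$ is non-zero only if $\Omega=\overline{R^{(\ell)}_{ij}\Lambda}$ for some $i<j$ and $\ell>0$, and for every such representation of $\Omega$ $$v_{\Lambda\Omega}(\beta)=2\beta\,\operatorname{sgn}\big(\sigma^a_{R^{(\ell)}_{ij}\Lambda}\big)\,\big(|\Lambda_i-\Lambda_j|-\delta\ell\big)\,n(a,b),\qquad a=(R^{(\ell)}_{ij}\Lambda)_i,\quad b=(R^{(\ell)}_{ij}\Lambda)_j,$$ where $\delta=2,1,0$ for $(i,j)$ of type I, II, III, and $n(a,b)$ equals $1$ for type I, $n_\Omega(b)$ for type II, $n_\Omega(a)n_\Omega(b)$ for type III with $a\ne b$, and $\tfrac12n_\Omega(a)(n_\Omega(a)-1)$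 for type III with $a=b$. -/

import Mathlib

open scoped TensorProduct BigOperators

namespace SuperCMS

noncomputable section

/-! ### Superfunctions

Bosonic variables `z_1, …, z_N` (commuting) and fermionic variables `θ_1, …, θ_N` (anticommuting),
over a coefficient field `k`. Indices run over `Fin N`, so they are shifted by one. -/

/-- Rational functions in the bosonic variables `z_1, …, z_N`. -/
abbrev RatFun (k : Type*) [Field k] (N : ℕ) : Type _ := FractionRing (MvPolynomial (Fin N) k)

/-- The Grassmann algebra generated by the fermionic variables `θ_1, …, θ_N`. -/
abbrev Grassmann (k : Type*) [Field k] (N : ℕ) : Type _ := ExteriorAlgebra k (Fin N → k)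

/-- Superfunctions: Grassmann-algebra valued rational functions of `z`. -/
abbrev SuperFun (k : Type*) [Field k] (N : ℕ) : Type _ := RatFun k N ⊗[k] Grassmann k N

section Operators

variable {k : Type*} [Field k] {N : ℕ}

/-- The variable `z_i` as a rational function. -/
def zvar (i : Fin N) : RatFun k N := algebraMap (MvPolynomial (Fin N) k) _ (MvPolynomial.X i)

/-- The variable `θ_i` of the Grassmann algebra. -/
def theta (i : Fin N) : Grassmann k N := ExteriorAlgebra.ι k (Pi.single i 1)

/-- `∂/∂z_i` on rational functions, by the quotient rule. -/
def dzFun (i : Fin N) (f : RatFun k N) : RatFun k N :=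
  letI p := IsFractionRing.num (MvPolynomial (Fin N) k) f
  letI q : MvPolynomial (Fin N) k := IsFractionRing.den (MvPolynomial (Fin N) k) f
  algebraMap (MvPolynomial (Fin N) k) (RatFun k N)
      (MvPolynomial.pderiv i p * q - p * MvPolynomial.pderiv i q) /
    algebraMap (MvPolynomial (Fin N) k) (RatFun k N) (q ^ 2)

/-- The quotient rule holds for every representation of a rational function as a fraction. -/
theorem dzFun_div (i : Fin N) (p q : MvPolynomial (Fin N) k) (hq : q ≠ 0) :
    dzFun i (algebraMap _ (RatFun k N) p / algebraMap _ (RatFun k N) q) =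
      algebraMap _ (RatFun k N) (MvPolynomial.pderiv i p * q - p * MvPolynomial.pderiv i q) /
        algebraMap _ (RatFun k N) (q ^ 2) := by
  have inj := IsFractionRing.injective (MvPolynomial (Fin N) k) (RatFun k N)
  set f : RatFun k N := algebraMap _ (RatFun k N) p / algebraMap _ (RatFun k N) q with hf
  unfold dzFun
  generalize hP : IsFractionRing.num (MvPolynomial (Fin N) k) f = P
  have hQ0 : (IsFractionRing.den (MvPolynomial (Fin N) k) f : MvPolynomial (Fin N) k) ≠ 0 :=
    nonZeroDivisors.coe_ne_zero _
  have hPQ : algebraMap (MvPolynomial (Fin N) k) (RatFun k N) P /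
      algebraMap _ (RatFun k N) (IsFractionRing.den (MvPolynomial (Fin N) k) f :
        MvPolynomial (Fin N) k) = f := by
    rw [← hP]
    have := IsFractionRing.mk'_num_den (MvPolynomial (Fin N) k) f
    rwa [IsFractionRing.mk'_eq_div] at this
  generalize (IsFractionRing.den (MvPolynomial (Fin N) k) f : MvPolynomial (Fin N) k) = Q
    at hQ0 hPQ ⊢
  have hq' : algebraMap (MvPolynomial (Fin N) k) (RatFun k N) q ≠ 0 :=
    fun h => hq (inj (by rw [h, map_zero]))
  have hQ' : algebraMap (MvPolynomial (Fin N) k) (RatFun k N) Q ≠ 0 :=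
    fun h => hQ0 (inj (by rw [h, map_zero]))
  have hcross : P * q = p * Q := by
    rw [hf, div_eq_div_iff hQ' hq', ← map_mul, ← map_mul] at hPQ
    exact inj hPQ
  have hd : MvPolynomial.pderiv i P * q + P * MvPolynomial.pderiv i q =
      MvPolynomial.pderiv i p * Q + p * MvPolynomial.pderiv i Q := by
    have := congrArg (MvPolynomial.pderiv i) hcross
    simp only [Derivation.leibniz, smul_eq_mul] at this
    linear_combination this
  rw [map_pow, map_pow, div_eq_div_iff (pow_ne_zero 2 hQ') (pow_ne_zero 2 hq'), ← map_pow,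
    ← map_pow, ← map_mul, ← map_mul]
  congr 1
  linear_combination q * Q * hd -
    (MvPolynomial.pderiv i q * Q + q * MvPolynomial.pderiv i Q) * hcross

/-- The derivation `∂/∂z_i` of rational functions, as a `k`-linear map. -/
def dz (i : Fin N) : RatFun k N →ₗ[k] RatFun k N where
  toFun := dzFun i
  map_add' f g := by
    have inj := IsFractionRing.injective (MvPolynomial (Fin N) k) (RatFun k N)
    obtain ⟨p, q, hq, rfl⟩ := IsFractionRing.div_surjective (A := MvPolynomial (Fin N) k) f
    obtain ⟨r, s, hs, rfl⟩ := IsFractionRing.div_surjective (A := MvPolynomial (Fin N) k) g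
    have hq0 := nonZeroDivisors.ne_zero hq
    have hs0 := nonZeroDivisors.ne_zero hs
    have hq' : algebraMap (MvPolynomial (Fin N) k) (RatFun k N) q ≠ 0 :=
      fun h => hq0 (inj (by rw [h, map_zero]))
    have hs' : algebraMap (MvPolynomial (Fin N) k) (RatFun k N) s ≠ 0 :=
      fun h => hs0 (inj (by rw [h, map_zero]))
    rw [div_add_div _ _ hq' hs', ← map_mul, ← map_mul, ← map_mul, ← map_add,
      dzFun_div i _ _ (mul_ne_zero hq0 hs0), dzFun_div i _ _ hq0, dzFun_div i _ _ hs0]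
    simp only [map_add, map_sub, map_mul, map_pow, Derivation.leibniz, smul_eq_mul]
    field_simp
    ring
  map_smul' c f := by
    obtain ⟨p, q, hq, rfl⟩ := IsFractionRing.div_surjective (A := MvPolynomial (Fin N) k) f
    have hq0 := nonZeroDivisors.ne_zero hq
    have hc : c • (algebraMap (MvPolynomial (Fin N) k) (RatFun k N) p / algebraMap _ _ q) =
        algebraMap _ (RatFun k N) (c • p) / algebraMap _ _ q := by
      rw [Algebra.algebraMap_eq_smul_one (c • p), smul_assoc, ← Algebra.algebraMap_eq_smul_one,
        smul_div_assoc]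
    rw [hc, dzFun_div i _ _ hq0, dzFun_div i _ _ hq0, Derivation.map_smul, smul_mul_assoc,
      smul_mul_assoc, ← smul_sub, Algebra.algebraMap_eq_smul_one (c • _), smul_assoc,
      ← Algebra.algebraMap_eq_smul_one, smul_div_assoc, RingHom.id_apply]

/-- On polynomials `dz` is the usual partial derivative. -/
theorem dz_algebraMap (i : Fin N) (p : MvPolynomial (Fin N) k) :
    dz i (algebraMap _ (RatFun k N) p) = algebraMap _ (RatFun k N) (MvPolynomial.pderiv i p) := by
  have h := dzFun_div i p 1 one_ne_zero
  rw [map_one, div_one] at h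
  rw [show dz i (algebraMap _ (RatFun k N) p) = dzFun i (algebraMap _ (RatFun k N) p) from rfl, h]
  simp

/-- Multiplication by the rational function `f`, on superfunctions. -/
def mulZ (f : RatFun k N) : Module.End k (SuperFun k N) :=
  LinearMap.mulLeft k (f ⊗ₜ[k] (1 : Grassmann k N))

/-- Multiplication on the left by `θ_i`, on superfunctions. -/
def mulTheta (i : Fin N) : Module.End k (SuperFun k N) :=
  LinearMap.mulLeft k ((1 : RatFun k N) ⊗ₜ[k] theta i)

/-- The Euler operator `z_i ∂_{z_i}`, on superfunctions. -/
def euler (i : Fin N) : Module.End k (SuperFun k N) :=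
  mulZ (zvar i) * LinearMap.rTensor (Grassmann k N) (dz i)

/-- The (left) Grassmann derivative `∂_{θ_i}`, on superfunctions. -/
def dtheta (i : Fin N) : Module.End k (SuperFun k N) :=
  LinearMap.lTensor (RatFun k N)
    (CliffordAlgebra.contractLeft (Q := (0 : QuadraticForm k (Fin N → k))) (LinearMap.proj i))

/-- The fermionic exchange operator `κ_{ij} = 1 - (θ_i - θ_j)(∂_{θ_i} - ∂_{θ_j})`. -/
def kappa (i j : Fin N) : Module.End k (SuperFun k N) :=
  1 - (mulTheta i - mulTheta j) * (dtheta i - dtheta j)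

/-- The pairs of indices `i < j`. -/
def pairs (N : ℕ) : Finset (Fin N × Fin N) := Finset.univ.filter fun p => p.1 < p.2

/-- The two-body operator `(zᵢ+zⱼ)/(zᵢ-zⱼ) (zᵢ∂ᵢ-zⱼ∂ⱼ)`. -/
def bosonTerm (i j : Fin N) : Module.End k (SuperFun k N) :=
  mulZ ((zvar i + zvar j) / (zvar i - zvar j)) * (euler i - euler j)

/-- The two-body operator `zᵢzⱼ/(zᵢ-zⱼ)² (1-κᵢⱼ)`. -/
def fermionTerm (i j : Fin N) : Module.End k (SuperFun k N) :=
  mulZ (zvar i * zvar j / (zvar i - zvar j) ^ 2) * (1 - kappa i j)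

/-- The gauge-transformed Hamiltonian
`∑ᵢ (zᵢ∂ᵢ)² + β ∑_{i<j} (zᵢ+zⱼ)/(zᵢ-zⱼ) (zᵢ∂ᵢ-zⱼ∂ⱼ) - 2β ∑_{i<j} zᵢzⱼ/(zᵢ-zⱼ)² (1-κᵢⱼ)`. -/
def hamiltonian (β : k) : Module.End k (SuperFun k N) :=
  ∑ i : Fin N, euler i ^ 2 + β • ∑ p ∈ pairs N, bosonTerm p.1 p.2
    - (2 * β) • ∑ p ∈ pairs N, fermionTerm p.1 p.2

end Operators

/-! ### Superpartitions -/

/-- A superpartition `(Λ_1, …, Λ_m; Λ_{m+1}, …, Λ_N)` in the `m`-fermion sector: the first `m` parts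
are strictly decreasing and the last `N - m` parts are weakly decreasing. -/
@[ext] structure Superpartition (N m : ℕ) where
  m_le : m ≤ N
  part : Fin N → ℕ
  antisymm_part : ∀ i j : Fin N, i < j → (j : ℕ) < m → part j < part i
  symm_part : ∀ i j : Fin N, m ≤ (i : ℕ) → i ≤ j → part j ≤ part i

namespace Superpartition

variable {N m : ℕ}

/-- `Λ^*`: the parts of `Λ` rearranged in decreasing order. -/
def star (L : Superpartition N m) (j : Fin N) : ℕ := L.part (Tuple.sort L.part (Fin.rev j))

/-- `n_{λ^s}(a)`: the number of parts equal to `a` in the symmetric part of `Λ`. -/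
def symmMult (L : Superpartition N m) (a : ℕ) : ℕ :=
  (Finset.univ.filter fun j : Fin N => m ≤ (j : ℕ) ∧ L.part j = a).card

/-- `f_Λ = n_{λ^s}(0)! n_{λ^s}(1)! n_{λ^s}(2)! ⋯`. -/
def normFactor (L : Superpartition N m) : ℕ :=
  ∏ a ∈ Finset.univ.image L.part, (L.symmMult a).factorial

/-- `ε_Λ = ∑ⱼ [(Λ*_j)² + β (N + 1 - 2j) Λ*_j]`, where `j` runs from `1` to `N`. -/
def eigenvalue {k : Type*} [Field k] (β : k) (L : Superpartition N m) : k :=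
  ∑ j : Fin N, ((L.star j : k) ^ 2 + β * ((N : k) + 1 - 2 * ((j : ℕ) + 1 : k)) * (L.star j : k))

/-- `𝒦_σ (θ_1 ⋯ θ_m z^Λ) = θ_{σ(1)} ⋯ θ_{σ(m)} z_{σ(1)}^{Λ_1} ⋯ z_{σ(N)}^{Λ_N}`. -/
def term (k : Type*) [Field k] (L : Superpartition N m) (σ : Equiv.Perm (Fin N)) : SuperFun k N :=
  (∏ i : Fin N, zvar (σ i) ^ L.part i) ⊗ₜ[k]
    (List.ofFn fun i : Fin m => theta (k := k) (σ (Fin.castLE L.m_le i))).prod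

/-- The supermonomial `m_Λ = (1 / f_Λ) ∑_{σ ∈ S_N} 𝒦_σ (θ_1 ⋯ θ_m z^Λ)`. -/
def monomial (k : Type*) [Field k] (L : Superpartition N m) : SuperFun k N :=
  (L.normFactor : k)⁻¹ • ∑ σ : Equiv.Perm (Fin N), L.term k σ

/-- The sequence `R_{ij}^{(ℓ)} Λ`, when `R_{ij}^{(ℓ)}` does not annihilate `Λ`: the larger of the
parts `Λ_i`, `Λ_j` is lowered by `ℓ`, and the smaller one is raised by `ℓ`. -/
def lower (L : Superpartition N m) (i j : Fin N) (l : ℕ) : Fin N → ℕ :=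
  if L.part j < L.part i then
    Function.update (Function.update L.part i (L.part i - l)) j (L.part j + l)
  else
    Function.update (Function.update L.part i (L.part i + l)) j (L.part j - l)

/-- The condition under which `R_{ij}^{(ℓ)}` (for `i < j`) does not annihilate `Λ`; the three
lines are the pairs of type I, II and III. Integer division by `2` is the floor. -/
def Admissible (L : Superpartition N m) (i j : Fin N) (l : ℕ) : Prop :=
  i < j ∧
    (((j : ℕ) < m ∧ (l : ℤ) ≤ ((L.part i : ℤ) - L.part j - 1) / 2) ∨
     ((i : ℕ) < m ∧ m ≤ (j : ℕ) ∧ (l : ℤ) ≤ |(L.part i : ℤ) - L.part j| - 1) ∨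
     (m ≤ (i : ℕ) ∧ (l : ℤ) ≤ ((L.part i : ℤ) - L.part j) / 2))

/-- `Ω` is the superpartition `γ̄` obtained from the sequence `γ` by rearranging its first `m`
entries with the permutation `σa` and its last `N - m` entries with the permutation `σs`. -/
def IsBar (γ : Fin N → ℕ) (Om : Superpartition N m) (σa σs : Equiv.Perm (Fin N)) : Prop :=
  (∀ i : Fin N, m ≤ (i : ℕ) → σa i = i) ∧ (∀ i : Fin N, (i : ℕ) < m → σs i = i) ∧
    ∀ i : Fin N, Om.part ((σa * σs) i) = γ i

/-- `Ω` is the superpartition `\overline{R_{ij}^{(ℓ)} Λ}`, with `R_{ij}^{(ℓ)} Λ` non-zero. -/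
def IsLowering (L : Superpartition N m) (i j : Fin N) (l : ℕ) (Om : Superpartition N m) : Prop :=
  L.Admissible i j l ∧ ∃ σa σs : Equiv.Perm (Fin N), IsBar (L.lower i j l) Om σa σs

/-- `Ω ≤ˢ Λ`: `Ω` is obtained from `Λ` by a finite (possibly empty) sequence of operators
`R_{ij}^{(ℓ)}`, each followed by the rearrangement into a superpartition. -/
def LeS (Om L : Superpartition N m) : Prop :=
  Relation.ReflTransGen (fun A B : Superpartition N m => ∃ i j l, A.IsLowering i j l B) L Om

/-- `Ω <ˢ Λ`. -/
def LtS (Om L : Superpartition N m) : Prop := LeS Om L ∧ Om ≠ L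

/-- `δ = 2, 1, 0` for a pair `i < j` of type I, II, III. -/
def delta (m : ℕ) (i j : Fin N) : ℕ :=
  if (j : ℕ) < m then 2 else if (i : ℕ) < m then 1 else 0

/-- The symmetry factor `n(a, b)` for a pair `i < j`. -/
def symmFactor (k : Type*) [Field k] (Om : Superpartition N m) (i j : Fin N) (a b : ℕ) : k :=
  if (j : ℕ) < m then 1
  else if (i : ℕ) < m then (Om.symmMult b : k)
  else if a ≠ b then (Om.symmMult a : k) * (Om.symmMult b : k)
  else (1 / 2) * (Om.symmMult a : k) * ((Om.symmMult a : k) - 1)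

/-- The coefficient attached to `Ω = \overline{R_{ij}^{(ℓ)} Λ}`, where the permutation `σa` sorts the
antisymmetric part of `R_{ij}^{(ℓ)} Λ`. -/
def coeff {k : Type*} [Field k] (β : k) (L Om : Superpartition N m) (i j : Fin N) (l : ℕ)
    (σa : Equiv.Perm (Fin N)) : k :=
  if L.part j < L.part i then
    2 * β * ((Equiv.Perm.sign σa : ℤ) : k) *
      ((L.part i : k) - (L.part j : k) - (delta m i j : k) * (l : k)) *
      symmFactor k Om i j (L.part i - l) (L.part j + l)
  else
    2 * β * ((Equiv.Perm.sign σa : ℤ) : k) *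
      ((L.part j : k) - (L.part i : k) - (delta m i j : k) * (l : k)) *
      symmFactor k Om i j (L.part i + l) (L.part j - l)

end Superpartition

end

end SuperCMS

open SuperCMS

/-! The two-body terms are singular at z_p = z_q, but κ_{pq} merely exchanges θ_p and θ_q, so on an
orbit sum ∑_σ 𝒦_σ(θ_1⋯θ_m z^γ) the terms of σ and σ·(i j) can be treated together. With d = |γ_i −
γ_j|, the coefficient of each θ-product then reduces to the scalar identity `two_body_scalar`, in
which the poles cancel. After averaging over S_N, the pair (i, j) contributes d times the orbit sum
of γ plus 2 ∑_{0<l<d} (d − l) times the orbit sum of γ lowered by l (`hamiltonian_orbitSum`). The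
diagonal coefficient ∑ γ_i² + β ∑_{i<j} |γ_i − γ_j| is ε_Λ when evaluated on the sorted parts
(`eigenvalue_eq`).

The orbit sum of any sequence is a signed multiple of a supermonomial: permuting the first m entries
produces a sign, permuting the others changes nothing, and a repeated fermionic entry kills the sum
(`orbitSum_eq_sum`). So the coefficient of m_Ω is 2β f_Ω/f_Λ times the signed count, weighted by d −
l, of the lowerings of Λ that rearrange to Ω.

Comparing the entries removed and created by two lowerings with the same Ω shows that they differ
only by interchanging equal bosonic parts and, for types I and III, by l ↔ d − l, which exchanges
the two new entries. The weights d − l and l are subtracted in type I and added in type III, while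
only d − l occurs in type II; this is the factor d − δl. In type III with 2l = d the two choices
coincide, whence the factor 1/2. The ratio f_Ω/f_Λ turns multiplicities in Λ into multiplicities in
Ω.

Lowerings preserve the sum of the parts, which gives finiteness, and those with l > 0 strictly
decrease the sum of squares, which gives Ω ≠ Λ. -/

namespace SuperCMS

noncomputable section

/-! ### The exchange operator and the two-body operators on single terms. -/

section TwoBody

variable {k : Type*} [Field k] {N m : ℕ}

/-! ### The fermionic exchange operator on products of Grassmann generators -/

/-- The reflection `1 - u d` on products of generators, where `d` is the contraction with a
linear form. -/
theorem sub_ι_mul_contractLeft_prod {V : Type*} [AddCommGroup V] [Module k V]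
    (u : V) (d : Module.Dual k V) (vs : List V) :
    ((vs.map (ExteriorAlgebra.ι k)).prod - ExteriorAlgebra.ι k u *
        CliffordAlgebra.contractLeft (Q := (0 : QuadraticForm k V)) d
          (vs.map (ExteriorAlgebra.ι k)).prod : ExteriorAlgebra k V) =
      (vs.map fun v => ExteriorAlgebra.ι k (v - d v • u)).prod := by
  induction vs with
  | nil => simp
  | cons v vs ih =>
    -- Anticommutation absorbs the sign of the twisted Leibniz rule, and u² = 0 removes the cross
    -- term; together they make 1 − u d multiplicative on generators.
    have hanti : ExteriorAlgebra.ι k u * ExteriorAlgebra.ι k v =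
        -(ExteriorAlgebra.ι k v * ExteriorAlgebra.ι k u) :=
      eq_neg_of_add_eq_zero_left (ExteriorAlgebra.ι_add_mul_swap u v)
    have hsq : ExteriorAlgebra.ι k u * ExteriorAlgebra.ι k u = 0 := ExteriorAlgebra.ι_sq_zero u
    simp only [List.map_cons, List.prod_cons]
    rw [← ih]
    have hc := CliffordAlgebra.contractLeft_ι_mul (Q := (0 : QuadraticForm k V)) d v
      (vs.map (ExteriorAlgebra.ι k)).prod
    generalize (vs.map (ExteriorAlgebra.ι k)).prod = x at hc ⊢
    change CliffordAlgebra.contractLeft (Q := (0 : QuadraticForm k V)) d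
      (ExteriorAlgebra.ι k v * x) = d v • x - ExteriorAlgebra.ι k v *
        CliffordAlgebra.contractLeft (Q := (0 : QuadraticForm k V)) d x at hc
    rw [hc]
    generalize CliffordAlgebra.contractLeft (Q := (0 : QuadraticForm k V)) d x = y
    rw [map_sub, map_smul, sub_mul, mul_sub, mul_sub, mul_sub, smul_mul_assoc, smul_mul_assoc,
      ← mul_assoc (ExteriorAlgebra.ι k u) (ExteriorAlgebra.ι k u) y, hsq, zero_mul, smul_zero,
      ← mul_assoc (ExteriorAlgebra.ι k u), hanti, mul_smul_comm, neg_mul, mul_assoc]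
    abel

/-- The product `θ_{σ(1)} ⋯ θ_{σ(m)}`. -/
def thetaProd (k : Type*) [Field k] (hm : m ≤ N) (σ : Equiv.Perm (Fin N)) : Grassmann k N :=
  (List.ofFn fun i : Fin m => theta (k := k) (σ (Fin.castLE hm i))).prod

theorem thetaProd_eq_map_prod (hm : m ≤ N) (σ : Equiv.Perm (Fin N)) :
    thetaProd k hm σ = ((List.ofFn fun i : Fin m => (Pi.single (σ (Fin.castLE hm i)) 1 : Fin N → k)).map
      (ExteriorAlgebra.ι k)).prod := by
  rw [List.map_ofFn]; rfl

/-- The linear form `x ↦ x_p - x_q`. -/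
def coordDiff (p q : Fin N) : Module.Dual k (Fin N → k) :=
  (LinearMap.proj p : (Fin N → k) →ₗ[k] k) - (LinearMap.proj q : (Fin N → k) →ₗ[k] k)

theorem coordDiff_apply (p q : Fin N) (x : Fin N → k) : coordDiff p q x = x p - x q := rfl

/-- Transpositions of two coordinate vectors are reflections. -/
theorem single_swap (p q a : Fin N) :
    (Pi.single a 1 : Fin N → k) - coordDiff p q
      (Pi.single a 1 : Fin N → k) • (Pi.single p 1 - Pi.single q 1) =
      Pi.single (Equiv.swap p q a) 1 := by
  rcases eq_or_ne p q with rfl | hpq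
  · simp
  rw [coordDiff_apply]
  rcases eq_or_ne a p with rfl | hp
  · rw [Equiv.swap_apply_left, Pi.single_eq_same, Pi.single_eq_of_ne (Ne.symm hpq)]; simp
  rcases eq_or_ne a q with rfl | hq
  · rw [Equiv.swap_apply_right, Pi.single_eq_same, Pi.single_eq_of_ne (Ne.symm hp)]; simp
  · rw [Equiv.swap_apply_of_ne_of_ne hp hq, Pi.single_eq_of_ne (Ne.symm hp),
      Pi.single_eq_of_ne (Ne.symm hq)]; simp

theorem thetaProd_exchange (hm : m ≤ N) (σ : Equiv.Perm (Fin N)) (p q : Fin N) :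
    thetaProd k hm σ - (theta p - theta q) *
      CliffordAlgebra.contractLeft (Q := (0 : QuadraticForm k (Fin N → k)))
        (coordDiff p q) (thetaProd k hm σ) =
      thetaProd k hm (Equiv.swap p q * σ) := by
  have h := sub_ι_mul_contractLeft_prod (k := k) (Pi.single p 1 - Pi.single q 1 : Fin N → k)
    (coordDiff p q)
    (List.ofFn fun i : Fin m => (Pi.single (σ (Fin.castLE hm i)) 1 : Fin N → k))
  rw [← thetaProd_eq_map_prod, map_sub] at h
  refine h.trans ?_
  rw [thetaProd, List.map_ofFn]
  congr 2
  funext i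
  simp only [Function.comp, single_swap]
  rfl

theorem mulZ_tmul (f g : RatFun k N) (x : Grassmann k N) :
    mulZ f (g ⊗ₜ[k] x) = (f * g) ⊗ₜ[k] x := by
  simp [mulZ]

/-- The operator κ is 1 − u d for u = e_p − e_q and d = x_p − x_q, and the corresponding reflection
of coordinate vectors is the transposition of p and q. -/
theorem kappa_tmul_thetaProd (hm : m ≤ N) (f : RatFun k N) (σ : Equiv.Perm (Fin N))
    (p q : Fin N) :
    kappa p q (f ⊗ₜ[k] thetaProd k hm σ) = f ⊗ₜ[k] thetaProd k hm (Equiv.swap p q * σ) := by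
  rw [← thetaProd_exchange, coordDiff]
  simp only [kappa, mulTheta, dtheta, LinearMap.sub_apply, Module.End.one_apply,
    Module.End.mul_apply, LinearMap.lTensor_tmul, map_sub, LinearMap.mulLeft_apply,
    Algebra.TensorProduct.tmul_mul_tmul, one_mul, TensorProduct.tmul_sub, sub_mul, mul_sub]

/-! ### Euler operators on monomials -/

/-- The monomial `z_{σ(1)}^{γ_1} ⋯ z_{σ(N)}^{γ_N}`. -/
def zmon (k : Type*) [Field k] (γ : Fin N → ℕ) (σ : Equiv.Perm (Fin N)) : RatFun k N :=
  ∏ i : Fin N, zvar (σ i) ^ γ i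

theorem zmon_add (γ δ : Fin N → ℕ) (σ : Equiv.Perm (Fin N)) :
    zmon k (γ + δ) σ = zmon k γ σ * zmon k δ σ := by
  simp [zmon, pow_add, Finset.prod_mul_distrib]

theorem zmon_single (i : Fin N) (a : ℕ) (σ : Equiv.Perm (Fin N)) :
    zmon k (Pi.single i a) σ = zvar (σ i) ^ a := by
  rw [zmon, Finset.prod_eq_single i]
  · simp
  · intro j _ hj; simp [Pi.single_eq_of_ne hj]
  · simp

theorem zmon_mul_right (γ : Fin N → ℕ) (σ τ : Equiv.Perm (Fin N)) :
    zmon k (γ ∘ τ) (σ * τ) = zmon k γ σ :=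
  Equiv.prod_comp τ fun i => (zvar (σ i) : RatFun k N) ^ γ i

theorem zmon_eq_algebraMap (γ : Fin N → ℕ) (σ : Equiv.Perm (Fin N)) :
    zmon k γ σ = algebraMap (MvPolynomial (Fin N) k) _
      (MvPolynomial.monomial (Finsupp.equivFunOnFinite.symm (γ ∘ σ.symm)) 1) := by
  rw [MvPolynomial.monomial_eq, map_one, one_mul, Finsupp.prod_fintype _ _ (by simp), map_prod, zmon]
  refine (Equiv.prod_comp σ.symm _).symm.trans ?_
  simp [zvar]

theorem euler_zmon_tmul (γ : Fin N → ℕ) (σ : Equiv.Perm (Fin N)) (i : Fin N)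
    (x : Grassmann k N) :
    euler (σ i) (zmon k γ σ ⊗ₜ[k] x) = (γ i : k) • (zmon k γ σ ⊗ₜ[k] x) := by
  rw [euler, Module.End.mul_apply, LinearMap.rTensor_tmul, mulZ_tmul, zmon_eq_algebraMap,
    dz_algebraMap, zvar, ← map_mul, MvPolynomial.X_mul_pderiv_monomial]
  simp [TensorProduct.smul_tmul', Nat.cast_smul_eq_nsmul]

/-! ### The two-body operator -/

theorem zvar_ne_zvar {p q : Fin N} (h : p ≠ q) : (zvar p : RatFun k N) ≠ zvar q := fun h' =>
  h (MvPolynomial.X_injective (IsFractionRing.injective (MvPolynomial (Fin N) k) (RatFun k N) h'))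

/-- The two-body operator in the Hamiltonian. -/
def pairOp (k : Type*) [Field k] (p q : Fin N) : Module.End k (SuperFun k N) :=
  bosonTerm p q - (2 : k) • fermionTerm p q

theorem one_sub_sub_mul_sub_comm {A : Type*} [Ring A] (a b c d : A) :
    1 - (a - b) * (c - d) = 1 - (b - a) * (d - c) := by
  rw [← neg_sub b, ← neg_sub d, neg_mul_neg]

theorem kappa_comm (p q : Fin N) : (kappa p q : Module.End k (SuperFun k N)) = kappa q p :=
  one_sub_sub_mul_sub_comm (mulTheta (k := k) p) (mulTheta q) (dtheta p) (dtheta q)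

theorem mulZ_neg (f : RatFun k N) : mulZ (-f) = -mulZ f :=
  LinearMap.ext fun x => (congrArg (· * x) (TensorProduct.neg_tmul f 1)).trans (neg_mul _ x)

theorem neg_mul_sub_swap {A : Type*} [Ring A] (a b c : A) : -a * (b - c) = a * (c - b) := by
  rw [← neg_sub c, neg_mul_neg]

/-- In the bosonic term both factors change sign, and the fermionic term is even. This symmetry
allows pairs of variables to be relabelled freely by permutations. -/
theorem pairOp_comm (p q : Fin N) : pairOp k p q = pairOp k q p := by
  have h1 : (zvar p + zvar q : RatFun k N) / (zvar p - zvar q) =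
      -((zvar q + zvar p) / (zvar q - zvar p)) := by
    rw [← neg_sub (zvar q), div_neg, add_comm]
  have h2 : (zvar p * zvar q : RatFun k N) / (zvar p - zvar q) ^ 2 =
      zvar q * zvar p / (zvar q - zvar p) ^ 2 := by
    rw [← neg_sub (zvar q), neg_sq, mul_comm]
  rw [pairOp, pairOp, bosonTerm, bosonTerm, fermionTerm, fermionTerm, kappa_comm p q, h1, h2,
    mulZ_neg]
  exact congrArg (· - _) (neg_mul_sub_swap (mulZ _) (euler (k := k) p) (euler q))

theorem add_smul_sum_sub_smul_sum {M ι : Type*} [AddCommGroup M] [Module k M] (s : Finset ι)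
    (β : k) (a : M) (f g : ι → M) :
    a + β • ∑ p ∈ s, f p - (2 * β) • ∑ p ∈ s, g p = a + β • ∑ p ∈ s, (f p - (2 : k) • g p) := by
  rw [Finset.sum_sub_distrib, ← Finset.smul_sum, smul_sub, smul_smul, mul_comm β 2, add_sub_assoc]

theorem hamiltonian_eq (β : k) : (hamiltonian β : Module.End k (SuperFun k N)) =
    ∑ i : Fin N, euler i ^ 2 + β • ∑ p ∈ pairs N, pairOp k p.1 p.2 :=
  add_smul_sum_sub_smul_sum (pairs N) β _ (fun p => bosonTerm (k := k) p.1 p.2) fun p => fermionTerm p.1 p.2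

/-- The term `𝒦_σ (θ_1 ⋯ θ_m z^γ)` attached to an arbitrary sequence `γ`. -/
def seqTerm (k : Type*) [Field k] (hm : m ≤ N) (γ : Fin N → ℕ) (σ : Equiv.Perm (Fin N)) :
    SuperFun k N :=
  zmon k γ σ ⊗ₜ[k] thetaProd k hm σ

theorem pairOp_seqTerm (hm : m ≤ N) (γ : Fin N → ℕ) (σ : Equiv.Perm (Fin N)) (i j : Fin N) :
    pairOp k (σ i) (σ j) (seqTerm k hm γ σ) =
      ((zvar (σ i) + zvar (σ j)) / (zvar (σ i) - zvar (σ j)) *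
        (((γ i : RatFun k N) - (γ j : RatFun k N)) * zmon k γ σ)) ⊗ₜ[k] thetaProd k hm σ -
      (2 * (zvar (σ i) * zvar (σ j) / (zvar (σ i) - zvar (σ j)) ^ 2 * zmon k γ σ)) ⊗ₜ[k]
        (thetaProd k hm σ - thetaProd k hm (σ * Equiv.swap i j)) := by
  have hk := kappa_tmul_thetaProd hm (zmon k γ σ) σ (σ i) (σ j)
  -- Conjugation by σ turns the exchange of the variables σ i and σ j into an exchange of the
  -- positions i and j.
  rw [← Equiv.mul_swap_eq_swap_mul] at hk
  have hb : bosonTerm (σ i) (σ j) (seqTerm k hm γ σ) =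
      ((zvar (σ i) + zvar (σ j)) / (zvar (σ i) - zvar (σ j)) *
        (((γ i : RatFun k N) - (γ j : RatFun k N)) * zmon k γ σ)) ⊗ₜ[k] thetaProd k hm σ := by
    rw [bosonTerm, seqTerm, Module.End.mul_apply, LinearMap.sub_apply, euler_zmon_tmul,
      euler_zmon_tmul]
    refine (congrArg _ (sub_smul (γ i : k) (γ j : k) (zmon k γ σ ⊗ₜ[k] thetaProd k hm σ)).symm).trans ?_
    rw [TensorProduct.smul_tmul', mulZ_tmul, Algebra.smul_def, map_sub, map_natCast, map_natCast]
  have hf : (2 : k) • fermionTerm (σ i) (σ j) (seqTerm k hm γ σ) =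
      (2 * (zvar (σ i) * zvar (σ j) / (zvar (σ i) - zvar (σ j)) ^ 2 * zmon k γ σ)) ⊗ₜ[k]
        (thetaProd k hm σ - thetaProd k hm (σ * Equiv.swap i j)) := by
    rw [fermionTerm, seqTerm, Module.End.mul_apply, LinearMap.sub_apply, hk, Module.End.one_apply]
    refine (congrArg ((2 : k) • mulZ _ ·) (TensorProduct.tmul_sub (zmon k γ σ) _ _).symm).trans ?_
    rw [mulZ_tmul, TensorProduct.smul_tmul', Algebra.smul_def, map_ofNat]
  rw [pairOp, LinearMap.sub_apply, LinearMap.smul_apply, hb, hf]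

end TwoBody

/-! ### Cancellation of the poles and averaging over the symmetric group. -/

section Average

variable {k : Type*} [Field k] {N m : ℕ}

/-- This is p ∂_p of a geometric sum, cleared of denominators. The induction splits off the term l =
0 and pulls a factor q out of the rest. -/
theorem sq_sub_mul_sum_pow_mul_pow {K : Type*} [CommRing K] (p q : K) (d : ℕ) :
    (p - q) ^ 2 * ∑ l ∈ Finset.range d, ((d - l : ℕ) : K) * (p ^ (d - l) * q ^ l) =
      d * p ^ (d + 1) * (p - q) - p * q * (p ^ d - q ^ d) := by
  induction d with
  | zero => simp
  | succ d ih =>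
    have h : ∑ l ∈ Finset.range d, ((d + 1 - (l + 1) : ℕ) : K) *
        (p ^ (d + 1 - (l + 1)) * q ^ (l + 1)) =
        q * ∑ l ∈ Finset.range d, ((d - l : ℕ) : K) * (p ^ (d - l) * q ^ l) := by
      rw [Finset.mul_sum]
      refine Finset.sum_congr rfl fun l _ => ?_
      rw [Nat.add_sub_add_right, pow_succ q]
      ring
    rw [Finset.sum_range_succ', h, mul_add, mul_left_comm, ih]
    simp only [Nat.sub_zero, pow_zero, Nat.cast_succ]
    ring

/-- The two-body identity behind the triangularity, as an identity between scalars. -/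
theorem two_body_scalar {K : Type*} [Field K] {p q : K} (h : p ≠ q) (d : ℕ) :
    (p + q) / (p - q) * (d * p ^ d) - 2 * (p * q / (p - q) ^ 2 * p ^ d) +
        2 * (p * q / (p - q) ^ 2 * q ^ d) =
      d * p ^ d + ∑ l ∈ Finset.Ico 1 d, 2 * ((d - l : ℕ) : K) * (p ^ (d - l) * q ^ l) := by
  have hpq : p - q ≠ 0 := sub_ne_zero.mpr h
  have key := sq_sub_mul_sum_pow_mul_pow p q d
  -- Extending the sum to l = 0 adds 2d p^d, so that the closed form of the full weighted sum
  -- applies.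
  have hS : ∑ l ∈ Finset.Ico 1 d, 2 * ((d - l : ℕ) : K) * (p ^ (d - l) * q ^ l) =
      2 * ∑ l ∈ Finset.range d, ((d - l : ℕ) : K) * (p ^ (d - l) * q ^ l) - 2 * (d * p ^ d) := by
    rcases d.eq_zero_or_pos with rfl | hd
    · simp
    rw [Finset.range_eq_Ico, Finset.sum_eq_sum_Ico_succ_bot hd]
    simp only [mul_assoc, ← Finset.mul_sum, Nat.sub_zero, pow_zero, mul_one, zero_add]
    ring
  rw [hS]
  generalize ∑ l ∈ Finset.range d, ((d - l : ℕ) : K) * (p ^ (d - l) * q ^ l) = S at key ⊢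
  refine mul_left_cancel₀ (pow_ne_zero 2 hpq) ?_
  field_simp
  linear_combination (-2 : K) * key

/-- The gap between two entries of a sequence. -/
def gap (γ : Fin N → ℕ) (i j : Fin N) : ℕ := (γ i - γ j) + (γ j - γ i)

/-- The larger of the entries `γ_i`, `γ_j` is lowered by `l`, the smaller one is raised. -/
def lowerSeq (γ : Fin N → ℕ) (i j : Fin N) (l : ℕ) : Fin N → ℕ :=
  if γ j < γ i then Function.update (Function.update γ i (γ i - l)) j (γ j + l)
  else Function.update (Function.update γ i (γ i + l)) j (γ j - l)

theorem gap_comm (γ : Fin N → ℕ) (i j : Fin N) : gap γ i j = gap γ j i := add_comm _ _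

theorem seqTerm_add_seqTerm_smul (c : ℕ) (A B : RatFun k N) (X Y : Grassmann k N) :
    (c : k) • (A ⊗ₜ[k] X + B ⊗ₜ[k] Y) = ((c : RatFun k N) * A) ⊗ₜ[k] X +
      ((c : RatFun k N) * B) ⊗ₜ[k] Y := by
  rw [smul_add, TensorProduct.smul_tmul', TensorProduct.smul_tmul', Algebra.smul_def,
    Algebra.smul_def, map_natCast]

theorem tmul_sub_add_tmul_sub (A B C D : RatFun k N) (X Y : Grassmann k N) :
    A ⊗ₜ[k] X - B ⊗ₜ[k] (X - Y) + (C ⊗ₜ[k] Y - D ⊗ₜ[k] (Y - X)) =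
      (A - B + D) ⊗ₜ[k] X + (C - D + B) ⊗ₜ[k] Y := by
  have h : ∀ (E : RatFun k N) (Z W : Grassmann k N),
      E ⊗ₜ[k] (Z - W) = E ⊗ₜ[k] Z - E ⊗ₜ[k] W := fun E Z W => TensorProduct.tmul_sub E Z W
  have h' : ∀ (E F : RatFun k N) (Z : Grassmann k N),
      (E - F) ⊗ₜ[k] Z = E ⊗ₜ[k] Z - F ⊗ₜ[k] Z := fun E F Z => TensorProduct.sub_tmul E F Z
  rw [h, h, TensorProduct.add_tmul, TensorProduct.add_tmul, h', h']
  abel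

/-- Neither summand alone is free of poles. In the sum, κ applied to the swapped term supplies the
q^d part of the coefficient of the θ-product of σ, and conversely, so each coefficient is an
instance of `two_body_scalar`, once with (p, q) and once with (q, p). -/
theorem pairOp_add_swap_of_le (hm : m ≤ N) (γ : Fin N → ℕ) (σ : Equiv.Perm (Fin N))
    {i j : Fin N} (hij : i ≠ j) (hle : γ j ≤ γ i) :
    pairOp k (σ i) (σ j) (seqTerm k hm γ σ) +
        pairOp k (σ i) (σ j) (seqTerm k hm γ (σ * Equiv.swap i j)) =
      ((γ i - γ j : ℕ) : k) • (seqTerm k hm γ σ + seqTerm k hm γ (σ * Equiv.swap i j)) +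
      ∑ l ∈ Finset.Ico 1 (γ i - γ j), ((2 * (γ i - γ j - l) : ℕ) : k) •
        (seqTerm k hm (Function.update (Function.update γ i (γ i - l)) j (γ j + l)) σ +
         seqTerm k hm (Function.update (Function.update γ i (γ i - l)) j (γ j + l))
           (σ * Equiv.swap i j)) := by
  have hop : pairOp k (σ i) (σ j) = pairOp k ((σ * Equiv.swap i j) i) ((σ * Equiv.swap i j) j) := by
    rw [pairOp_comm]; simp
  nth_rw 2 [hop]
  rw [pairOp_seqTerm, pairOp_seqTerm, mul_assoc, Equiv.swap_mul_self, mul_one,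
    tmul_sub_add_tmul_sub]
  simp only [Equiv.Perm.mul_apply, Equiv.swap_apply_left, Equiv.swap_apply_right]
  -- Lowering the larger entry to the smaller one gives a monomial unchanged by the swap. It is a
  -- common factor of everything, and what remains are powers of the two variables of total degree
  -- d.
  set γ' : Fin N → ℕ := Function.update γ i (γ j) with hγ'
  have hγ'swap : γ' ∘ Equiv.swap i j = γ' := by
    funext x
    rcases eq_or_ne x i with rfl | hi
    · simp [hγ', hij.symm]
    rcases eq_or_ne x j with rfl | hj
    · simp [hγ', hij.symm]
    · simp [Equiv.swap_apply_of_ne_of_ne hi hj]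
  have hM : zmon k γ' (σ * Equiv.swap i j) = zmon k γ' σ := by
    conv_lhs => rw [← hγ'swap]
    exact zmon_mul_right γ' σ _
  have hdec : ∀ l, l ≤ γ i - γ j →
      Function.update (Function.update γ i (γ i - l)) j (γ j + l) =
        γ' + Pi.single i (γ i - γ j - l) + Pi.single j l := by
    intro l hl
    funext x
    rcases eq_or_ne x j with rfl | hj
    · simp [hγ', hij.symm]
    rcases eq_or_ne x i with rfl | hi
    · simp only [hγ', Pi.add_apply, Function.update_self, Function.update_of_ne hij,
        Pi.single_eq_same, Pi.single_eq_of_ne hij]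
      omega
    · simp [hγ', hi, hj]
  have hz : ∀ l, l ≤ γ i - γ j → ∀ τ : Equiv.Perm (Fin N),
      zmon k (Function.update (Function.update γ i (γ i - l)) j (γ j + l)) τ =
        zmon k γ' τ * (zvar (τ i) ^ (γ i - γ j - l) * zvar (τ j) ^ l) := by
    intro l hl τ
    rw [hdec l hl, zmon_add, zmon_add, zmon_single, zmon_single, mul_assoc]
  have hz0 : ∀ τ : Equiv.Perm (Fin N), zmon k γ τ = zmon k γ' τ * zvar (τ i) ^ (γ i - γ j) := by
    intro τ
    have := hz 0 (Nat.zero_le _) τ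
    simpa using this
  have hsum : ∀ l ∈ Finset.Ico 1 (γ i - γ j), ((2 * (γ i - γ j - l) : ℕ) : k) •
        (seqTerm k hm (Function.update (Function.update γ i (γ i - l)) j (γ j + l)) σ +
         seqTerm k hm (Function.update (Function.update γ i (γ i - l)) j (γ j + l))
           (σ * Equiv.swap i j)) =
      (zmon k γ' σ * (2 * ((γ i - γ j - l : ℕ) : RatFun k N) * (zvar (σ i) ^ (γ i - γ j - l) *
        zvar (σ j) ^ l))) ⊗ₜ[k] thetaProd k hm σ +
      (zmon k γ' σ * (2 * ((γ i - γ j - l : ℕ) : RatFun k N) * (zvar (σ j) ^ (γ i - γ j - l) *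
        zvar (σ i) ^ l))) ⊗ₜ[k] thetaProd k hm (σ * Equiv.swap i j) := by
    intro l hl
    rw [Finset.mem_Ico] at hl
    rw [seqTerm, seqTerm, seqTerm_add_seqTerm_smul, hz l hl.2.le, hz l hl.2.le, hM]
    simp only [Equiv.Perm.mul_apply, Equiv.swap_apply_left, Equiv.swap_apply_right]
    congr 2
    · push_cast; ring
    · push_cast; ring
  rw [Finset.sum_congr rfl hsum, Finset.sum_add_distrib, ← TensorProduct.sum_tmul,
    ← TensorProduct.sum_tmul, ← Finset.mul_sum, ← Finset.mul_sum, seqTerm, seqTerm,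
    seqTerm_add_seqTerm_smul, hz0, hz0, hM]
  simp only [Equiv.Perm.mul_apply, Equiv.swap_apply_left]
  rw [add_add_add_comm, ← TensorProduct.add_tmul, ← TensorProduct.add_tmul]
  have hne : σ i ≠ σ j := fun h => hij (σ.injective h)
  have h1 := two_body_scalar (zvar_ne_zvar (k := k) hne) (γ i - γ j)
  have h2 := two_body_scalar (zvar_ne_zvar (k := k) hne.symm) (γ i - γ j)
  congr 2
  -- Coefficient of the θ-product of σ; the other bullet treats that of σ·(i j), with the two
  -- variables interchanged.
  · rw [eq_sub_of_add_eq' h1.symm, Nat.cast_sub hle]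
    have e : (zvar (σ j) * zvar (σ i) / (zvar (σ j) - zvar (σ i)) ^ 2 : RatFun k N) =
        zvar (σ i) * zvar (σ j) / (zvar (σ i) - zvar (σ j)) ^ 2 := by
      rw [← neg_sub (zvar (σ i)), neg_sq, mul_comm]
    rw [e]
    ring
  · rw [eq_sub_of_add_eq' h2.symm, Nat.cast_sub hle]
    have e : (zvar (σ j) * zvar (σ i) / (zvar (σ j) - zvar (σ i)) ^ 2 : RatFun k N) =
        zvar (σ i) * zvar (σ j) / (zvar (σ i) - zvar (σ j)) ^ 2 := by
      rw [← neg_sub (zvar (σ i)), neg_sq, mul_comm]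
    rw [e]
    ring

theorem pairOp_add_swap (hm : m ≤ N) (γ : Fin N → ℕ) (σ : Equiv.Perm (Fin N))
    {i j : Fin N} (hij : i ≠ j) :
    pairOp k (σ i) (σ j) (seqTerm k hm γ σ) +
        pairOp k (σ i) (σ j) (seqTerm k hm γ (σ * Equiv.swap i j)) =
      (gap γ i j : k) • (seqTerm k hm γ σ + seqTerm k hm γ (σ * Equiv.swap i j)) +
      ∑ l ∈ Finset.Ico 1 (gap γ i j), ((2 * (gap γ i j - l) : ℕ) : k) •
        (seqTerm k hm (lowerSeq γ i j l) σ +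
         seqTerm k hm (lowerSeq γ i j l) (σ * Equiv.swap i j)) := by
  rcases lt_or_ge (γ j) (γ i) with h | h
  · have hg : gap γ i j = γ i - γ j := by unfold gap; omega
    rw [pairOp_add_swap_of_le hm γ σ hij h.le, hg]
    simp only [lowerSeq, if_pos h]
  · have hg : gap γ i j = γ j - γ i := by unfold gap; omega
    rw [pairOp_comm, Equiv.swap_comm, pairOp_add_swap_of_le hm γ σ hij.symm h, hg]
    simp only [lowerSeq, if_neg h.not_gt, Function.update_comm hij.symm]

/-- The sum of all terms `𝒦_σ (θ_1 ⋯ θ_m z^γ)`. -/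
def orbitSum (k : Type*) [Field k] (hm : m ≤ N) (γ : Fin N → ℕ) : SuperFun k N :=
  ∑ σ : Equiv.Perm (Fin N), seqTerm k hm γ σ

theorem eq_of_add_self_eq_add_self {M : Type*} [AddCommGroup M] [Module k M] [CharZero k]
    {a b : M} (h : a + a = b + b) : a = b := by
  rw [← two_smul k, ← two_smul k] at h
  exact (smul_right_injective M (two_ne_zero (α := k))) h

/-- Averaging a formula for `f σ + f (σ τ)` over the group, where `τ` is an involution. -/
theorem sum_perm_eq_of_add_swap {G M ι : Type*} [Group G] [Fintype G] [AddCommGroup M] [Module k M]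
    [CharZero k] (τ : G) (f g : G → M) (h : ι → G → M) (s : Finset ι) (c : k) (d : ι → ℕ)
    (hf : ∀ σ, f σ + f (σ * τ) = c • (g σ + g (σ * τ)) +
      ∑ l ∈ s, ((2 * d l : ℕ) : k) • (h l σ + h l (σ * τ))) :
    ∑ σ, f σ = c • ∑ σ, g σ + (2 : k) • ∑ l ∈ s, (d l : k) • ∑ σ, h l σ := by
  have hshift : ∀ u : G → M, ∑ σ, u (σ * τ) = ∑ σ, u σ := fun u =>
    Equiv.sum_comp (Equiv.mulRight τ) u
  -- Double the sum and reindex one copy by right translation by τ, so that the hypothesis applies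
  -- termwise; halving at the end needs 2 ≠ 0.
  refine eq_of_add_self_eq_add_self (k := k) ?_
  nth_rw 2 [← hshift f]
  rw [← Finset.sum_add_distrib, Finset.sum_congr rfl fun σ _ => hf σ, Finset.sum_add_distrib,
    ← Finset.smul_sum, Finset.sum_add_distrib, hshift, Finset.sum_comm]
  have : ∀ l ∈ s, ∑ σ, ((2 * d l : ℕ) : k) • (h l σ + h l (σ * τ)) =
      (2 : k) • (d l : k) • (∑ σ, h l σ + ∑ σ, h l σ) := by
    intro l _
    rw [← Finset.smul_sum, Finset.sum_add_distrib, hshift, smul_smul, Nat.cast_mul, Nat.cast_ofNat]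
  rw [Finset.sum_congr rfl this, ← Finset.smul_sum]
  simp only [smul_add, Finset.sum_add_distrib]
  abel

theorem sum_pairOp_seqTerm [CharZero k] (hm : m ≤ N) (γ : Fin N → ℕ) {i j : Fin N} (hij : i ≠ j) :
    ∑ σ, pairOp k (σ i) (σ j) (seqTerm k hm γ σ) =
      (gap γ i j : k) • orbitSum k hm γ + (2 : k) • ∑ l ∈ Finset.Ico 1 (gap γ i j),
        ((gap γ i j - l : ℕ) : k) • orbitSum k hm (lowerSeq γ i j l) := by
  refine sum_perm_eq_of_add_swap (Equiv.swap i j) _ _ (fun l => seqTerm k hm (lowerSeq γ i j l)) _ _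
    (fun l => gap γ i j - l) fun σ => ?_
  rw [← pairOp_add_swap hm γ σ hij]
  congr 2
  simp [pairOp_comm]

/-- Sums over pairs of a symmetric function are invariant under permutations. -/
theorem sum_pairs_perm {M : Type*} [AddCommMonoid M] (f : Fin N → Fin N → M)
    (hf : ∀ p q, f p q = f q p) (σ : Equiv.Perm (Fin N)) :
    ∑ p ∈ pairs N, f (σ p.1) (σ p.2) = ∑ p ∈ pairs N, f p.1 p.2 := by
  -- The image of an increasing pair is put back in increasing order by `min` and `max`.
  refine Finset.sum_bij' (fun p _ => (min (σ p.1) (σ p.2), max (σ p.1) (σ p.2)))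
    (fun p _ => (min (σ.symm p.1) (σ.symm p.2), max (σ.symm p.1) (σ.symm p.2))) ?_ ?_ ?_ ?_ ?_
  all_goals
    rintro ⟨p, q⟩ h
    simp only [pairs, Finset.mem_filter, Finset.mem_univ, true_and] at h ⊢
  · have : σ p ≠ σ q := fun e => h.ne (σ.injective e)
    exact min_lt_max.mpr this
  · have : σ.symm p ≠ σ.symm q := fun e => h.ne (σ.symm.injective e)
    exact min_lt_max.mpr this
  · rcases le_total (σ p) (σ q) with h' | h' <;> simp [h', h.le]
  · rcases le_total (σ.symm p) (σ.symm q) with h' | h' <;> simp [h', h.le]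
  · rcases le_total (σ p) (σ q) with h' | h' <;> simp [h', hf (σ p)]

theorem sum_euler_sq_seqTerm (hm : m ≤ N) (γ : Fin N → ℕ) (σ : Equiv.Perm (Fin N)) :
    (∑ i, euler i ^ 2 : Module.End k (SuperFun k N)) (seqTerm k hm γ σ) =
      (∑ i, (γ i : k) ^ 2) • seqTerm k hm γ σ := by
  rw [LinearMap.sum_apply, ← Equiv.sum_comp σ, Finset.sum_smul]
  refine Finset.sum_congr rfl fun i _ => ?_
  rw [pow_two, Module.End.mul_apply, seqTerm, euler_zmon_tmul, map_smul, euler_zmon_tmul, smul_smul,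
    pow_two]

/-- The action of the Hamiltonian on the orbit sum of an arbitrary sequence. -/
theorem hamiltonian_orbitSum [CharZero k] (β : k) (hm : m ≤ N) (γ : Fin N → ℕ) :
    hamiltonian β (orbitSum k hm γ) =
      (∑ i, (γ i : k) ^ 2 + β * ∑ p ∈ pairs N, (gap γ p.1 p.2 : k)) • orbitSum k hm γ +
      (2 * β) • ∑ p ∈ pairs N, ∑ l ∈ Finset.Ico 1 (gap γ p.1 p.2),
        ((gap γ p.1 p.2 - l : ℕ) : k) • orbitSum k hm (lowerSeq γ p.1 p.2 l) := by
  have hE : (∑ i, euler i ^ 2 : Module.End k (SuperFun k N)) (orbitSum k hm γ) =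
      (∑ i, (γ i : k) ^ 2) • orbitSum k hm γ := by
    rw [orbitSum, map_sum, Finset.smul_sum]
    exact Finset.sum_congr rfl fun σ _ => sum_euler_sq_seqTerm hm γ σ
  -- For each σ the sum over pairs of variables becomes a sum over pairs of positions, where the
  -- swap average is available for a fixed (i, j).
  have hP : (∑ p ∈ pairs N, pairOp k p.1 p.2) (orbitSum k hm γ) =
      ∑ p ∈ pairs N, ∑ σ : Equiv.Perm (Fin N), pairOp k (σ p.1) (σ p.2) (seqTerm k hm γ σ) := by
    rw [orbitSum, map_sum, Finset.sum_comm]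
    refine Finset.sum_congr rfl fun σ _ => ?_
    rw [LinearMap.sum_apply]
    exact (sum_pairs_perm (fun p q => pairOp k p q (seqTerm k hm γ σ))
      (fun p q => by rw [pairOp_comm]) σ).symm
  have hP' : ∀ p ∈ pairs N, ∑ σ : Equiv.Perm (Fin N), pairOp k (σ p.1) (σ p.2) (seqTerm k hm γ σ) =
      (gap γ p.1 p.2 : k) • orbitSum k hm γ + (2 : k) • ∑ l ∈ Finset.Ico 1 (gap γ p.1 p.2),
        ((gap γ p.1 p.2 - l : ℕ) : k) • orbitSum k hm (lowerSeq γ p.1 p.2 l) := fun p hp =>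
    sum_pairOp_seqTerm hm γ (Finset.mem_filter.mp hp).2.ne
  rw [hamiltonian_eq, LinearMap.add_apply, LinearMap.smul_apply, hE, hP, Finset.sum_congr rfl hP',
    Finset.sum_add_distrib, ← Finset.sum_smul, ← Finset.smul_sum, smul_add, smul_smul, smul_smul,
    mul_comm β 2, add_smul, add_assoc]

end Average

/-! ### Rearrangement of sequences into superpartitions, with signs. -/

section Sorting

variable {k : Type*} [Field k] {N m : ℕ}

open Superpartition

/-! ### Permutations of the two blocks -/

theorem apply_lt_of_fix {σ : Equiv.Perm (Fin N)} (h : ∀ i : Fin N, m ≤ (i : ℕ) → σ i = i)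
    {i : Fin N} (hi : (i : ℕ) < m) : (σ i : ℕ) < m := by
  by_contra hc
  have := σ.injective (h (σ i) (not_lt.mp hc))
  rw [this] at hc
  exact hc hi

theorem le_apply_of_fix {σ : Equiv.Perm (Fin N)} (h : ∀ i : Fin N, (i : ℕ) < m → σ i = i)
    {i : Fin N} (hi : m ≤ (i : ℕ)) : m ≤ (σ i : ℕ) := by
  by_contra hc
  have := σ.injective (h (σ i) (not_le.mp hc))
  rw [this] at hc
  exact hc hi

/-- The product is an alternating function of its m factors, so τa contributes its sign. The
permutation τs fixes the first m positions and is not seen. -/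
theorem thetaProd_mul (hm : m ≤ N) (σ τa τs : Equiv.Perm (Fin N))
    (ha : ∀ i : Fin N, m ≤ (i : ℕ) → τa i = i) (hs : ∀ i : Fin N, (i : ℕ) < m → τs i = i) :
    thetaProd k hm (σ * (τa * τs)) = Equiv.Perm.sign τa • thetaProd k hm σ := by
  let e : Fin m ≃ {i : Fin N // (i : ℕ) < m} := (Fin.castLEquiv hm : _)
  have hiff : ∀ x : Fin N, ((τa x : Fin N) : ℕ) < m ↔ (x : ℕ) < m := fun x =>
    ⟨fun h => by
      by_contra hx
      rw [ha x (not_lt.mp hx)] at h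
      exact hx h, apply_lt_of_fix ha⟩
  -- The restriction of τa to the fermionic block; its sign is that of τa because τa moves no other
  -- point.
  let ρ : Equiv.Perm (Fin m) := e.symm.permCongr (τa.subtypePerm (p := fun x : Fin N => (x : ℕ) < m) hiff)
  have hρ : ∀ i, Fin.castLE hm (ρ i) = τa (Fin.castLE hm i) := fun i => rfl
  have hsign : Equiv.Perm.sign ρ = Equiv.Perm.sign τa := by
    rw [Equiv.Perm.sign_permCongr]
    refine Equiv.Perm.sign_subtypePerm _ _ fun x hx => ?_
    by_contra hc
    exact hx (ha x (not_lt.mp hc))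
  have key := AlternatingMap.map_perm (ExteriorAlgebra.ιMulti k m)
    (fun i : Fin m => (Pi.single (σ (Fin.castLE hm i)) 1 : Fin N → k)) ρ
  rw [hsign, ExteriorAlgebra.ιMulti_apply, ExteriorAlgebra.ιMulti_apply] at key
  refine Eq.trans ?_ key
  rw [thetaProd]
  congr 2
  funext i
  simp only [Function.comp, Equiv.Perm.mul_apply, hρ]
  rw [hs (Fin.castLE hm i) i.2]
  rfl

theorem orbitSum_comp (hm : m ≤ N) (γ : Fin N → ℕ) (τa τs : Equiv.Perm (Fin N))
    (ha : ∀ i : Fin N, m ≤ (i : ℕ) → τa i = i) (hs : ∀ i : Fin N, (i : ℕ) < m → τs i = i) :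
    orbitSum k hm (γ ∘ (τa * τs : Equiv.Perm (Fin N))) =
      ((Equiv.Perm.sign τa : ℤ) : k) • orbitSum k hm γ := by
  rw [orbitSum, orbitSum, ← Equiv.sum_comp (Equiv.mulRight (τa * τs)), Finset.smul_sum]
  refine Finset.sum_congr rfl fun σ _ => ?_
  simp only [Equiv.coe_mulRight, seqTerm]
  rw [zmon_mul_right, thetaProd_mul hm σ τa τs ha hs]
  rcases Int.units_eq_one_or (Equiv.Perm.sign τa) with h | h <;> rw [h]
  · simp
  · simp only [Units.neg_smul, one_smul, Units.val_neg, Units.val_one, Int.cast_neg, Int.cast_one,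
      neg_smul]
    exact TensorProduct.tmul_neg _ _

/-- Swapping the two equal fermionic entries fixes γ but reverses the sign of the orbit sum. -/
theorem orbitSum_eq_zero [CharZero k] (hm : m ≤ N) (γ : Fin N → ℕ) {p q : Fin N} (hpq : p ≠ q)
    (hp : (p : ℕ) < m) (hq : (q : ℕ) < m) (h : γ p = γ q) : orbitSum k hm γ = 0 := by
  have hc : γ ∘ (Equiv.swap p q * 1 : Equiv.Perm (Fin N)) = γ := by
    funext x
    simp only [mul_one, Function.comp]
    rcases eq_or_ne x p with rfl | hxp
    · rw [Equiv.swap_apply_left, h]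
    rcases eq_or_ne x q with rfl | hxq
    · rw [Equiv.swap_apply_right, h]
    · rw [Equiv.swap_apply_of_ne_of_ne hxp hxq]
  have := orbitSum_comp (k := k) hm γ (Equiv.swap p q) 1
    (fun i hi => Equiv.swap_apply_of_ne_of_ne (by rintro rfl; omega) (by rintro rfl; omega))
    fun _ _ => rfl
  rw [hc, Equiv.Perm.sign_swap hpq] at this
  refine eq_of_add_self_eq_add_self (k := k) ?_
  nth_rw 2 [this]
  rw [Units.val_neg, Units.val_one, Int.cast_neg, Int.cast_one, add_zero]
  exact (congrArg _ (neg_one_smul k _)).trans (add_neg_cancel _)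

/-! ### Sorting a sequence into a superpartition -/

theorem Superpartition.IsBar.part_of_lt {γ : Fin N → ℕ} {Om : Superpartition N m} {σa σs : Equiv.Perm (Fin N)}
    (h : IsBar γ Om σa σs) {i : Fin N} (hi : (i : ℕ) < m) : Om.part (σa i) = γ i := by
  rw [← h.2.2 i, Equiv.Perm.mul_apply, h.2.1 i hi]

theorem Superpartition.IsBar.part_of_le {γ : Fin N → ℕ} {Om : Superpartition N m} {σa σs : Equiv.Perm (Fin N)}
    (h : IsBar γ Om σa σs) {i : Fin N} (hi : m ≤ (i : ℕ)) : Om.part (σs i) = γ i := by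
  rw [← h.2.2 i, Equiv.Perm.mul_apply, h.1 _ (le_apply_of_fix h.2.1 hi)]

theorem isBar_of_parts {γ : Fin N → ℕ} {Om : Superpartition N m} {σa σs : Equiv.Perm (Fin N)}
    (ha : ∀ i : Fin N, m ≤ (i : ℕ) → σa i = i) (hs : ∀ i : Fin N, (i : ℕ) < m → σs i = i)
    (h1 : ∀ i : Fin N, (i : ℕ) < m → Om.part (σa i) = γ i)
    (h2 : ∀ i : Fin N, m ≤ (i : ℕ) → Om.part (σs i) = γ i) : IsBar γ Om σa σs := by
  refine ⟨ha, hs, fun i => ?_⟩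
  rcases lt_or_ge (i : ℕ) m with hi | hi
  · rw [Equiv.Perm.mul_apply, hs i hi, h1 i hi]
  · rw [Equiv.Perm.mul_apply, ha _ (le_apply_of_fix hs hi), h2 i hi]

/-- A sequence together with the block of each position, ordered lexicographically. -/
def blockKey (m : ℕ) (γ : Fin N → ℕ) (i : Fin N) : ℕ ×ₗ ℕ :=
  toLex (if (i : ℕ) < m then 1 else 0, γ i)

/-- The fermionic block has the larger first key, so two separately sorted blocks form one antitone
sequence. Existence and uniqueness of the rearrangement thus reduce to sorting a single tuple. -/
theorem blockKey_antitone (L : Superpartition N m) : Antitone (blockKey m L.part) := by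
  intro i j hij
  rw [blockKey, blockKey, Prod.Lex.toLex_le_toLex]
  have hij' : (i : ℕ) ≤ j := hij
  rcases lt_or_ge (j : ℕ) m with hj | hj
  · rw [if_pos hj, if_pos (hij'.trans_lt hj)]
    rcases hij.eq_or_lt with rfl | h
    · simp
    · exact Or.inr ⟨rfl, (L.antisymm_part i j h hj).le⟩
  · rcases lt_or_ge (i : ℕ) m with hi | hi
    · simp [hi, hj.not_gt]
    · simp [hi.not_gt, hj.not_gt, L.symm_part i j hi hij]

theorem Superpartition.IsBar.blockKey_eq {γ : Fin N → ℕ} {Om : Superpartition N m} {σa σs : Equiv.Perm (Fin N)}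
    (h : IsBar γ Om σa σs) :
    blockKey m γ ∘ (σa * σs).symm = blockKey m Om.part := by
  funext x
  obtain ⟨i, rfl⟩ := (σa * σs).surjective x
  simp only [Function.comp, Equiv.symm_apply_apply, blockKey, h.2.2 i]
  congr 2
  rw [Equiv.Perm.mul_apply]
  rcases lt_or_ge (i : ℕ) m with hi | hi
  · rw [h.2.1 i hi, if_pos hi, if_pos (apply_lt_of_fix h.1 hi)]
  · rw [h.1 _ (le_apply_of_fix h.2.1 hi), if_neg hi.not_gt,
      if_neg (le_apply_of_fix h.2.1 hi).not_gt]

theorem Superpartition.IsBar.unique {γ : Fin N → ℕ} {Om Om' : Superpartition N m}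
    {σa σs σa' σs' : Equiv.Perm (Fin N)} (h : IsBar γ Om σa σs) (h' : IsBar γ Om' σa' σs') :
    Om = Om' := by
  have e : blockKey m Om.part = blockKey m Om'.part := by
    rw [← h.blockKey_eq, ← h'.blockKey_eq]
    refine Tuple.unique_antitone ?_ ?_
    · rw [h.blockKey_eq]; exact blockKey_antitone Om
    · rw [h'.blockKey_eq]; exact blockKey_antitone Om'
  ext i
  exact congrArg (fun x => (ofLex x).2) (congrFun e i)

theorem part_injOn (L : Superpartition N m) {i j : Fin N} (hi : (i : ℕ) < m) (hj : (j : ℕ) < m)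
    (h : L.part i = L.part j) : i = j := by
  rcases lt_trichotomy i j with hij | hij | hij
  · exact absurd h (L.antisymm_part i j hij hj).ne'
  · exact hij
  · exact absurd h (L.antisymm_part j i hij hi).ne

/-- Fermionic parts are distinct, so the value of a part determines its position. The bosonic
permutation is not unique when parts coincide, but it carries no sign. -/
theorem Superpartition.IsBar.perm_unique {γ : Fin N → ℕ} {Om : Superpartition N m}
    {σa σs σa' σs' : Equiv.Perm (Fin N)} (h : IsBar γ Om σa σs) (h' : IsBar γ Om σa' σs') :
    σa = σa' := by
  ext1 i
  rcases lt_or_ge (i : ℕ) m with hi | hi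
  · exact part_injOn Om (apply_lt_of_fix h.1 hi) (apply_lt_of_fix h'.1 hi)
      ((h.part_of_lt hi).trans (h'.part_of_lt hi).symm)
  · rw [h.1 i hi, h'.1 i hi]

theorem Superpartition.IsBar.injOn {γ : Fin N → ℕ} {Om : Superpartition N m} {σa σs : Equiv.Perm (Fin N)}
    (h : IsBar γ Om σa σs) {i j : Fin N} (hi : (i : ℕ) < m) (hj : (j : ℕ) < m)
    (e : γ i = γ j) : i = j :=
  σa.injective (part_injOn Om (apply_lt_of_fix h.1 hi) (apply_lt_of_fix h.1 hj)
    (by rw [h.part_of_lt hi, h.part_of_lt hj, e]))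

theorem exists_isBar (hm : m ≤ N) (γ : Fin N → ℕ)
    (hγ : ∀ i j : Fin N, (i : ℕ) < m → (j : ℕ) < m → γ i = γ j → i = j) :
    ∃ (Om : Superpartition N m) (σa σs : Equiv.Perm (Fin N)), IsBar γ Om σa σs := by
  set σ := Tuple.sort (OrderDual.toDual ∘ blockKey m γ) with hσ
  have hanti : Antitone (blockKey m γ ∘ σ) := fun i j hij =>
    Tuple.monotone_sort (OrderDual.toDual ∘ blockKey m γ) hij
  -- The block indicator is antitone both before and after sorting, so sorting leaves it unchanged;
  -- hence σ preserves the two blocks.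
  have hind : (fun i : Fin N => if (i : ℕ) < m then (1 : ℕ) else 0) ∘ σ =
      (fun i : Fin N => if (i : ℕ) < m then (1 : ℕ) else 0) ∘ (1 : Equiv.Perm (Fin N)) := by
    refine Tuple.unique_antitone (fun i j hij => ?_) (fun i j hij => ?_)
    · have := hanti hij
      simp only [Function.comp, blockKey, Prod.Lex.toLex_le_toLex] at this ⊢
      exact this.elim le_of_lt fun h => h.1.le
    · have hij' : (i : ℕ) ≤ j := hij
      change (if (j : ℕ) < m then (1 : ℕ) else 0) ≤ if (i : ℕ) < m then 1 else 0
      by_cases hj : (j : ℕ) < m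
      · rw [if_pos hj, if_pos (hij'.trans_lt hj)]
      · rw [if_neg hj]; exact Nat.zero_le _
  have hblock : ∀ i : Fin N, ((σ i : Fin N) : ℕ) < m ↔ (i : ℕ) < m := fun i => by
    have := congrFun hind i
    simp only [Function.comp, Equiv.Perm.one_apply] at this
    by_cases h1 : ((σ i : Fin N) : ℕ) < m <;> by_cases h2 : (i : ℕ) < m <;> simp [h1, h2] at this ⊢
  have hle : ∀ i j : Fin N, i ≤ j → ((i : ℕ) < m ↔ (j : ℕ) < m) → γ (σ j) ≤ γ (σ i) := by
    intro i j hij hb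
    have := hanti hij
    simp only [Function.comp, blockKey, Prod.Lex.toLex_le_toLex, hblock, hb] at this
    exact this.elim (fun h => absurd h (lt_irrefl _)) fun h => h.2
  let Om : Superpartition N m :=
    { m_le := hm
      part := γ ∘ σ
      antisymm_part := fun i j hij hj => by
        have hij' : (i : ℕ) < j := hij
        have hi : (i : ℕ) < m := by omega
        refine lt_of_le_of_ne (hle i j hij.le (by simp [hi, hj])) fun e => hij.ne' ?_
        exact σ.injective (hγ _ _ ((hblock j).mpr hj) ((hblock i).mpr hi) e)
      symm_part := fun i j hi hij => by
        have hij' : (i : ℕ) ≤ j := hij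
        exact hle i j hij (by omega) }
  have hinv : ∀ i : Fin N, ((σ.symm i : Fin N) : ℕ) < m ↔ (i : ℕ) < m := fun i => by
    rw [← hblock, Equiv.apply_symm_apply]
  have hinv' : ∀ i : Fin N, m ≤ ((σ.symm i : Fin N) : ℕ) ↔ m ≤ (i : ℕ) := fun i => by
    rw [← not_lt, hinv, not_lt]
  -- The two sorting permutations are the restrictions of the inverse of σ to the blocks, extended
  -- by the identity.
  refine ⟨Om, Equiv.Perm.ofSubtype (Equiv.Perm.subtypePerm σ.symm (p := fun x : Fin N => (x : ℕ) < m) hinv),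
    Equiv.Perm.ofSubtype (Equiv.Perm.subtypePerm σ.symm (p := fun x : Fin N => m ≤ (x : ℕ)) hinv'),
    isBar_of_parts ?_ ?_ ?_ ?_⟩
  · intro i hi
    exact Equiv.Perm.ofSubtype_apply_of_not_mem _ hi.not_gt
  · intro i hi
    exact Equiv.Perm.ofSubtype_apply_of_not_mem _ hi.not_ge
  · intro i hi
    have h := Equiv.Perm.ofSubtype_apply_of_mem (p := fun x : Fin N => (x : ℕ) < m)
      (Equiv.Perm.subtypePerm σ.symm hinv) hi
    exact (congrArg Om.part h).trans (congrArg γ (Equiv.apply_symm_apply σ i))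
  · intro i hi
    have h := Equiv.Perm.ofSubtype_apply_of_mem (p := fun x : Fin N => m ≤ (x : ℕ))
      (Equiv.Perm.subtypePerm σ.symm hinv') hi
    exact (congrArg Om.part h).trans (congrArg γ (Equiv.apply_symm_apply σ i))

open Classical in
/-- The sign with which the sequence `γ` is rearranged into `Ω`, and `0` if it cannot be. -/
def barSign (k : Type*) [Field k] (γ : Fin N → ℕ) (Om : Superpartition N m) : k :=
  if h : ∃ σa σs : Equiv.Perm (Fin N), IsBar γ Om σa σs then ((Equiv.Perm.sign h.choose : ℤ) : k)
  else 0

theorem Superpartition.IsBar.barSign_eq {γ : Fin N → ℕ} {Om : Superpartition N m} {σa σs : Equiv.Perm (Fin N)}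
    (h : IsBar γ Om σa σs) : barSign k γ Om = ((Equiv.Perm.sign σa : ℤ) : k) := by
  have hex : ∃ σa σs : Equiv.Perm (Fin N), IsBar γ Om σa σs := ⟨σa, σs, h⟩
  rw [barSign, dif_pos hex]
  obtain ⟨σs', h'⟩ := hex.choose_spec
  rw [h'.perm_unique h]

theorem exists_isBar_of_barSign_ne_zero {γ : Fin N → ℕ} {Om : Superpartition N m}
    (h : barSign k γ Om ≠ 0) : ∃ σa σs : Equiv.Perm (Fin N), IsBar γ Om σa σs := by
  by_contra hc
  exact h (dif_neg hc)

theorem swap_fix_of_lt {p q : Fin N} (hp : (p : ℕ) < m) (hq : (q : ℕ) < m) (i : Fin N)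
    (hi : m ≤ (i : ℕ)) : Equiv.swap p q i = i :=
  Equiv.swap_apply_of_ne_of_ne (by rintro rfl; omega) (by rintro rfl; omega)

theorem swap_fix_of_le {p q : Fin N} (hp : m ≤ (p : ℕ)) (hq : m ≤ (q : ℕ)) (i : Fin N)
    (hi : (i : ℕ) < m) : Equiv.swap p q i = i :=
  Equiv.swap_apply_of_ne_of_ne (by rintro rfl; omega) (by rintro rfl; omega)

theorem Superpartition.IsBar.comp_swap_of_lt {γ : Fin N → ℕ} {Om : Superpartition N m}
    {σa σs : Equiv.Perm (Fin N)} (h : IsBar γ Om σa σs) {p q : Fin N} (hp : (p : ℕ) < m)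
    (hq : (q : ℕ) < m) : IsBar (γ ∘ Equiv.swap p q) Om (σa * Equiv.swap p q) σs := by
  refine isBar_of_parts (fun i hi => ?_) h.2.1 (fun i hi => ?_) fun i hi => ?_
  · rw [Equiv.Perm.mul_apply, swap_fix_of_lt hp hq i hi, h.1 i hi]
  · exact h.part_of_lt (apply_lt_of_fix (swap_fix_of_lt hp hq) hi)
  · rw [Function.comp_apply, swap_fix_of_lt hp hq i hi, h.part_of_le hi]

theorem Superpartition.IsBar.comp_swap_of_le {γ : Fin N → ℕ} {Om : Superpartition N m}
    {σa σs : Equiv.Perm (Fin N)} (h : IsBar γ Om σa σs) {p q : Fin N} (hp : m ≤ (p : ℕ))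
    (hq : m ≤ (q : ℕ)) : IsBar (γ ∘ Equiv.swap p q) Om σa (σs * Equiv.swap p q) := by
  refine isBar_of_parts h.1 (fun i hi => ?_) (fun i hi => ?_) fun i hi => ?_
  · rw [Equiv.Perm.mul_apply, swap_fix_of_le hp hq i hi, h.2.1 i hi]
  · rw [Function.comp_apply, swap_fix_of_le hp hq i hi, h.part_of_lt hi]
  · exact h.part_of_le (le_apply_of_fix (swap_fix_of_le hp hq) hi)

/-! ### Symmetry factors of sequences -/

/-- The number of entries equal to `a` in the symmetric part of a sequence. -/
def seqMult (m : ℕ) (γ : Fin N → ℕ) (a : ℕ) : ℕ :=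
  (Finset.univ.filter fun j : Fin N => m ≤ (j : ℕ) ∧ γ j = a).card

/-- The product of the factorials of the multiplicities in the symmetric part of a sequence. -/
def seqFactor (m : ℕ) (γ : Fin N → ℕ) : ℕ :=
  ∏ a ∈ Finset.univ.image γ, (seqMult m γ a).factorial

theorem seqFactor_eq_prod_of_subset (γ : Fin N → ℕ) {s : Finset ℕ} (h : Finset.univ.image γ ⊆ s) :
    seqFactor m γ = ∏ a ∈ s, (seqMult m γ a).factorial := by
  refine Finset.prod_subset h fun a _ ha => ?_
  have : seqMult m γ a = 0 := by
    refine Finset.card_eq_zero.mpr (Finset.filter_eq_empty_iff.mpr fun j _ hj => ha ?_)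
    exact Finset.mem_image.mpr ⟨j, Finset.mem_univ _, hj.2⟩
  rw [this, Nat.factorial_zero]

theorem seqFactor_ne_zero (γ : Fin N → ℕ) : seqFactor m γ ≠ 0 :=
  Finset.prod_ne_zero_iff.mpr fun _ _ => Nat.factorial_ne_zero _

theorem seqFactor_congr {γ δ : Fin N → ℕ} (h : ∀ a, seqMult m γ a = seqMult m δ a) :
    seqFactor m γ = seqFactor m δ := by
  rw [seqFactor_eq_prod_of_subset γ Finset.subset_union_left,
    seqFactor_eq_prod_of_subset δ (Finset.subset_union_right (s₁ := Finset.univ.image γ))]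
  exact Finset.prod_congr rfl fun a _ => by rw [h a]

theorem Superpartition.IsBar.symmMult_eq {γ : Fin N → ℕ} {Om : Superpartition N m} {σa σs : Equiv.Perm (Fin N)}
    (h : IsBar γ Om σa σs) (a : ℕ) : Om.symmMult a = seqMult m γ a := by
  refine (Finset.card_bij (fun i _ => σs i) ?_ (fun i _ j _ e => σs.injective e) ?_).symm
  · intro i hi
    simp only [Finset.mem_filter, Finset.mem_univ, true_and] at hi ⊢
    exact ⟨le_apply_of_fix h.2.1 hi.1, (h.part_of_le hi.1).trans hi.2⟩
  · intro j hj
    simp only [Finset.mem_filter, Finset.mem_univ, true_and] at hj ⊢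
    obtain ⟨i, rfl⟩ := σs.surjective j
    have hi : m ≤ (i : ℕ) := by
      by_contra hc
      rw [h.2.1 i (not_le.mp hc)] at hj
      exact hc hj.1
    exact ⟨i, ⟨hi, (h.part_of_le hi).symm.trans hj.2⟩, rfl⟩

theorem Superpartition.IsBar.normFactor_eq {γ : Fin N → ℕ} {Om : Superpartition N m}
    {σa σs : Equiv.Perm (Fin N)} (h : IsBar γ Om σa σs) : Om.normFactor = seqFactor m γ :=
  seqFactor_congr fun a => h.symmMult_eq a

theorem orbitSum_part [CharZero k] (L : Superpartition N m) :
    orbitSum k L.m_le L.part = (L.normFactor : k) • L.monomial k := by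
  have : (L.normFactor : k) ≠ 0 := Nat.cast_ne_zero.mpr (seqFactor_ne_zero (m := m) L.part)
  rw [Superpartition.monomial, smul_smul, mul_inv_cancel₀ this, one_smul]
  rfl

/-- The orbit sum of an arbitrary sequence as a multiple of a supermonomial. -/
theorem orbitSum_eq_sum [CharZero k] (hm : m ≤ N) (γ : Fin N → ℕ) (S : Finset (Superpartition N m))
    (hS : ∀ Om σa σs, IsBar γ Om σa σs → Om ∈ S) :
    orbitSum k hm γ = ∑ Om ∈ S, (barSign k γ Om * (Om.normFactor : k)) • Om.monomial k := by
  by_cases hex : ∃ (Om : Superpartition N m) (σa σs : Equiv.Perm (Fin N)), IsBar γ Om σa σs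
  · obtain ⟨Om, σa, σs, h⟩ := hex
    rw [Finset.sum_eq_single_of_mem Om (hS Om σa σs h)]
    · have e : γ = Om.part ∘ (σa * σs : Equiv.Perm (Fin N)) := funext fun i => (h.2.2 i).symm
      rw [h.barSign_eq, mul_smul, ← orbitSum_part, ← orbitSum_comp _ _ σa σs h.1 h.2.1, ← e]
    · intro Om' _ hne
      have : barSign k γ Om' = 0 := by
        by_contra hc
        obtain ⟨σa', σs', h'⟩ := exists_isBar_of_barSign_ne_zero hc
        exact hne (h'.unique h)
      rw [this, zero_mul, zero_smul]
  -- If γ has no rearrangement, two of its fermionic entries must agree.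
  · have h0 : orbitSum k hm γ = 0 := by
      by_contra hc
      refine hex (exists_isBar hm γ fun i j hi hj e => ?_)
      by_contra hij
      exact hc (orbitSum_eq_zero hm γ hij hi hj e)
    rw [h0, Finset.sum_eq_zero]
    intro Om _
    have : barSign k γ Om = 0 := by
      by_contra hc
      obtain ⟨σa, σs, h⟩ := exists_isBar_of_barSign_ne_zero hc
      exact hex ⟨Om, σa, σs, h⟩
    rw [this, zero_mul, zero_smul]

end Sorting

/-! ### Which lowerings have the same rearrangement, and how multiplicities change. -/

section Counting

variable {k : Type*} [Field k] {N m : ℕ}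

open Superpartition

/-! ### Statistics of lowered sequences -/

theorem sum_update (F : Fin N → ℕ → ℕ) (γ : Fin N → ℕ) (i : Fin N) (b : ℕ) :
    ∑ x, F x (Function.update γ i b x) + F i (γ i) = ∑ x, F x (γ x) + F i b := by
  rw [← Finset.add_sum_erase _ _ (Finset.mem_univ i),
    ← Finset.add_sum_erase _ (fun x => F x (γ x)) (Finset.mem_univ i), Function.update_self,
    Finset.sum_congr rfl fun x hx => by
      rw [Function.update_of_ne (Finset.ne_of_mem_erase hx)]]
  ring

theorem lowerSeq_left (γ : Fin N → ℕ) {i j : Fin N} (h : i ≠ j) (l : ℕ) :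
    lowerSeq γ i j l i = if γ j < γ i then γ i - l else γ i + l := by
  unfold lowerSeq
  split_ifs <;> simp [h]

theorem lowerSeq_right (γ : Fin N → ℕ) (i j : Fin N) (l : ℕ) :
    lowerSeq γ i j l j = if γ j < γ i then γ j + l else γ j - l := by
  unfold lowerSeq
  split_ifs <;> simp

theorem lowerSeq_of_ne (γ : Fin N → ℕ) {i j x : Fin N} (hi : x ≠ i) (hj : x ≠ j) (l : ℕ) :
    lowerSeq γ i j l x = γ x := by
  unfold lowerSeq
  split_ifs <;> simp [hi, hj]

theorem lowerSeq_eq_update (γ : Fin N → ℕ) {i j : Fin N} (h : i ≠ j) (l : ℕ) :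
    lowerSeq γ i j l =
      Function.update (Function.update γ i (lowerSeq γ i j l i)) j (lowerSeq γ i j l j) := by
  rw [lowerSeq_left γ h, lowerSeq_right]
  unfold lowerSeq
  split_ifs <;> rfl

/-- Only two summands change. Old and new ones stand on opposite sides to avoid truncated
subtraction. -/
theorem sum_lowerSeq (F : Fin N → ℕ → ℕ) (γ : Fin N → ℕ) {i j : Fin N} (h : i ≠ j) (l : ℕ) :
    ∑ x, F x (lowerSeq γ i j l x) + (F i (γ i) + F j (γ j)) =
      ∑ x, F x (γ x) + (F i (lowerSeq γ i j l i) + F j (lowerSeq γ i j l j)) := by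
  have h1 := sum_update F γ i (lowerSeq γ i j l i)
  have h2 := sum_update F (Function.update γ i (lowerSeq γ i j l i)) j (lowerSeq γ i j l j)
  rw [← lowerSeq_eq_update γ h, Function.update_of_ne h.symm] at h2
  omega

theorem Superpartition.IsBar.sum_eq {γ : Fin N → ℕ} {Om : Superpartition N m}
    {σa σs : Equiv.Perm (Fin N)} (h : IsBar γ Om σa σs) (F : Fin N → ℕ → ℕ)
    (hF : ∀ x y : Fin N, ((x : ℕ) < m ↔ (y : ℕ) < m) → F x = F y) :
    ∑ x, F x (γ x) = ∑ x, F x (Om.part x) := by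
  rw [← Equiv.sum_comp (σa * σs) fun x => F x (Om.part x)]
  refine Finset.sum_congr rfl fun x _ => ?_
  rw [h.2.2 x]
  refine congrFun (hF _ _ ?_) _
  rw [Equiv.Perm.mul_apply]
  rcases lt_or_ge (x : ℕ) m with hx | hx
  · rw [h.2.1 x hx]
    exact ⟨fun _ => apply_lt_of_fix h.1 hx, fun _ => hx⟩
  · rw [h.1 _ (le_apply_of_fix h.2.1 hx)]
    exact ⟨fun h' => absurd hx h'.not_ge, fun h' => absurd (le_apply_of_fix h.2.1 hx) h'.not_ge⟩

/-- Two lowerings of `Λ` with the same rearrangement exchange the same entries. -/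
theorem lowerSeq_balance {L Om : Superpartition N m} {i j i' j' : Fin N} {l l' : ℕ}
    {σa σs σa' σs' : Equiv.Perm (Fin N)} (hij : i ≠ j) (hij' : i' ≠ j')
    (h : IsBar (lowerSeq L.part i j l) Om σa σs) (h' : IsBar (lowerSeq L.part i' j' l') Om σa' σs')
    (F : Fin N → ℕ → ℕ) (hF : ∀ x y : Fin N, ((x : ℕ) < m ↔ (y : ℕ) < m) → F x = F y) :
    F i (L.part i) + F j (L.part j) +
        (F i' (lowerSeq L.part i' j' l' i') + F j' (lowerSeq L.part i' j' l' j')) =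
      F i' (L.part i') + F j' (L.part j') +
        (F i (lowerSeq L.part i j l i) + F j (lowerSeq L.part i j l j)) := by
  have h1 := sum_lowerSeq F L.part hij l
  have h2 := sum_lowerSeq F L.part hij' l'
  rw [h.sum_eq F hF] at h1
  rw [h'.sum_eq F hF] at h2
  omega

theorem lowerSeq_balance_antisymm {L Om : Superpartition N m} {i j i' j' : Fin N} {l l' : ℕ}
    {σa σs σa' σs' : Equiv.Perm (Fin N)} (hij : i ≠ j) (hij' : i' ≠ j')
    (h : IsBar (lowerSeq L.part i j l) Om σa σs) (h' : IsBar (lowerSeq L.part i' j' l') Om σa' σs')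
    (a : ℕ) :
    (if (i : ℕ) < m ∧ L.part i = a then 1 else 0) + (if (j : ℕ) < m ∧ L.part j = a then 1 else 0) +
      ((if (i' : ℕ) < m ∧ lowerSeq L.part i' j' l' i' = a then 1 else 0) +
        (if (j' : ℕ) < m ∧ lowerSeq L.part i' j' l' j' = a then 1 else 0)) =
    (if (i' : ℕ) < m ∧ L.part i' = a then 1 else 0) +
      (if (j' : ℕ) < m ∧ L.part j' = a then 1 else 0) +
      ((if (i : ℕ) < m ∧ lowerSeq L.part i j l i = a then 1 else 0) +
        (if (j : ℕ) < m ∧ lowerSeq L.part i j l j = a then 1 else 0)) :=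
  lowerSeq_balance hij hij' h h' (fun x v => if (x : ℕ) < m ∧ v = a then 1 else 0)
    fun x y hxy => by simp only [hxy]

theorem lowerSeq_balance_symm {L Om : Superpartition N m} {i j i' j' : Fin N} {l l' : ℕ}
    {σa σs σa' σs' : Equiv.Perm (Fin N)} (hij : i ≠ j) (hij' : i' ≠ j')
    (h : IsBar (lowerSeq L.part i j l) Om σa σs) (h' : IsBar (lowerSeq L.part i' j' l') Om σa' σs')
    (a : ℕ) :
    (if ¬ (i : ℕ) < m ∧ L.part i = a then 1 else 0) +
      (if ¬ (j : ℕ) < m ∧ L.part j = a then 1 else 0) +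
      ((if ¬ (i' : ℕ) < m ∧ lowerSeq L.part i' j' l' i' = a then 1 else 0) +
        (if ¬ (j' : ℕ) < m ∧ lowerSeq L.part i' j' l' j' = a then 1 else 0)) =
    (if ¬ (i' : ℕ) < m ∧ L.part i' = a then 1 else 0) +
      (if ¬ (j' : ℕ) < m ∧ L.part j' = a then 1 else 0) +
      ((if ¬ (i : ℕ) < m ∧ lowerSeq L.part i j l i = a then 1 else 0) +
        (if ¬ (j : ℕ) < m ∧ lowerSeq L.part i j l j = a then 1 else 0)) :=
  lowerSeq_balance hij hij' h h' (fun x v => if ¬ (x : ℕ) < m ∧ v = a then 1 else 0)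
    fun x y hxy => by simp only [hxy]

/-- Applied to a value removed by the first lowering and not recreated by it: such a value must also
be removed by the second. -/
theorem or_of_balance_left {p₁ p₂ q₁ q₂ r₁ r₂ s₁ s₂ : Prop} [Decidable p₁] [Decidable p₂]
    [Decidable q₁] [Decidable q₂] [Decidable r₁] [Decidable r₂] [Decidable s₁] [Decidable s₂]
    (h : (if p₁ then 1 else 0) + (if p₂ then 1 else 0) +
        ((if q₁ then 1 else 0) + (if q₂ then 1 else 0)) =
      (if r₁ then 1 else 0) + (if r₂ then 1 else 0) +
        ((if s₁ then 1 else 0) + (if s₂ then 1 else 0)))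
    (hp : p₁ ∨ p₂) (h₁ : ¬ s₁) (h₂ : ¬ s₂) : r₁ ∨ r₂ := by
  by_contra hc
  rw [not_or] at hc
  rw [if_neg hc.1, if_neg hc.2, if_neg h₁, if_neg h₂] at h
  rcases hp with hp | hp <;> rw [if_pos hp] at h <;> omega

theorem or_of_balance_right {p₁ p₂ q₁ q₂ r₁ r₂ s₁ s₂ : Prop} [Decidable p₁] [Decidable p₂]
    [Decidable q₁] [Decidable q₂] [Decidable r₁] [Decidable r₂] [Decidable s₁] [Decidable s₂]
    (h : (if p₁ then 1 else 0) + (if p₂ then 1 else 0) +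
        ((if q₁ then 1 else 0) + (if q₂ then 1 else 0)) =
      (if r₁ then 1 else 0) + (if r₂ then 1 else 0) +
        ((if s₁ then 1 else 0) + (if s₂ then 1 else 0)))
    (hs : s₁ ∨ s₂) (h₁ : ¬ p₁) (h₂ : ¬ p₂) : q₁ ∨ q₂ := by
  by_contra hc
  rw [not_or] at hc
  rw [if_neg hc.1, if_neg hc.2, if_neg h₁, if_neg h₂] at h
  rcases hs with hs | hs <;> rw [if_pos hs] at h <;> omega

/-- A lowering by a positive amount smaller than the gap changes both entries involved. -/
theorem lowerSeq_values {γ : Fin N → ℕ} {i j : Fin N} (hij : i ≠ j) {l : ℕ} (h0 : 0 < l)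
    (hl : l < gap γ i j) :
    (γ j < γ i ∧ lowerSeq γ i j l i = γ i - l ∧ lowerSeq γ i j l j = γ j + l ∧ l < γ i - γ j) ∨
      (γ i < γ j ∧ lowerSeq γ i j l i = γ i + l ∧ lowerSeq γ i j l j = γ j - l ∧
        l < γ j - γ i) := by
  rw [lowerSeq_left γ hij, lowerSeq_right]
  unfold gap at hl
  split_ifs with h
  · left; omega
  · right; omega

theorem part_le_of_not_mixed (L : Superpartition N m) {i j : Fin N} (hij : i < j)
    (h : (j : ℕ) < m ∨ m ≤ (i : ℕ)) : L.part j ≤ L.part i :=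
  h.elim (fun h => (L.antisymm_part i j hij h).le) fun h => L.symm_part i j h hij.le

/-- Both lowerings remove the same two fermionic values, and distinctness of fermionic parts turns
values into positions. The new value at i must reappear at i or at j, which leaves l and gap − l. -/
theorem eq_of_isBar_lowerSeq_antisymm {L Om : Superpartition N m} {i j i' j' : Fin N} {l l' : ℕ}
    {σa σs σa' σs' : Equiv.Perm (Fin N)} (hij : i < j) (hij' : i' < j')
    (h0 : 0 < l) (hl : l < gap L.part i j) (h0' : 0 < l') (hl' : l' < gap L.part i' j')
    (h : IsBar (lowerSeq L.part i j l) Om σa σs) (h' : IsBar (lowerSeq L.part i' j' l') Om σa' σs')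
    (hj : (j : ℕ) < m) : i' = i ∧ j' = j ∧ (l' = l ∨ l' = gap L.part i j - l) := by
  have hi : (i : ℕ) < m := lt_trans hij hj
  have hb := lowerSeq_balance_antisymm hij.ne hij'.ne h h'
  have hv := lowerSeq_values hij.ne h0 hl
  have hv' := lowerSeq_values hij'.ne h0' hl'
  have hx : ((i' : ℕ) < m ∧ L.part i' = L.part i) ∨ ((j' : ℕ) < m ∧ L.part j' = L.part i) :=
    or_of_balance_left (hb (L.part i)) (Or.inl ⟨hi, rfl⟩) (by omega) (by omega)
  have hy : ((i' : ℕ) < m ∧ L.part i' = L.part j) ∨ ((j' : ℕ) < m ∧ L.part j' = L.part j) :=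
    or_of_balance_left (hb (L.part j)) (Or.inr ⟨hj, rfl⟩) (by omega) (by omega)
  have hx' : i' = i ∨ j' = i :=
    hx.imp (fun h => part_injOn L h.1 hi h.2) fun h => part_injOn L h.1 hi h.2
  have hy' : i' = j ∨ j' = j :=
    hy.imp (fun h => part_injOn L h.1 hj h.2) fun h => part_injOn L h.1 hj h.2
  have e : i' = i ∧ j' = j := by
    rcases hx' with rfl | rfl <;> rcases hy' with rfl | rfl
    · exact absurd hij (lt_irrefl _)
    · exact ⟨rfl, rfl⟩
    · exact absurd hij' hij.not_gt
    · exact absurd hij (lt_irrefl _)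
  obtain ⟨rfl, rfl⟩ := e
  refine ⟨rfl, rfl, ?_⟩
  have h3 : lowerSeq L.part i' j' l' i' = lowerSeq L.part i' j' l i' ∨
      lowerSeq L.part i' j' l' j' = lowerSeq L.part i' j' l i' :=
    (or_of_balance_right (hb (lowerSeq L.part i' j' l i')) (Or.inl ⟨hi, rfl⟩) (by omega)
      (by omega)).imp And.right And.right
  unfold gap
  omega

/-- Each block loses one value. The fermionic one fixes i, the bosonic one fixes j only up to equal
parts. The new values lie in different blocks and cannot be exchanged, so l is determined. -/
theorem eq_of_isBar_lowerSeq_mixed {L Om : Superpartition N m} {i j i' j' : Fin N} {l l' : ℕ}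
    {σa σs σa' σs' : Equiv.Perm (Fin N)} (hij : i < j) (hij' : i' < j')
    (h0 : 0 < l) (hl : l < gap L.part i j) (h0' : 0 < l') (hl' : l' < gap L.part i' j')
    (h : IsBar (lowerSeq L.part i j l) Om σa σs) (h' : IsBar (lowerSeq L.part i' j' l') Om σa' σs')
    (hi : (i : ℕ) < m) (hj : m ≤ (j : ℕ)) :
    i' = i ∧ m ≤ (j' : ℕ) ∧ L.part j' = L.part j ∧ l' = l := by
  have hb := lowerSeq_balance_antisymm hij.ne hij'.ne h h'
  have hb' := lowerSeq_balance_symm hij.ne hij'.ne h h'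
  have hv := lowerSeq_values hij.ne h0 hl
  have hv' := lowerSeq_values hij'.ne h0' hl'
  have hlt : (i' : ℕ) < j' := hij'
  have hx : ((i' : ℕ) < m ∧ L.part i' = L.part i) ∨ ((j' : ℕ) < m ∧ L.part j' = L.part i) :=
    or_of_balance_left (hb (L.part i)) (Or.inl ⟨hi, rfl⟩) (by omega) (by omega)
  have hy : (¬ (i' : ℕ) < m ∧ L.part i' = L.part j) ∨ (¬ (j' : ℕ) < m ∧ L.part j' = L.part j) :=
    or_of_balance_left (hb' (L.part j)) (Or.inr ⟨hj.not_gt, rfl⟩) (by omega) (by omega)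
  have hj' : m ≤ (j' : ℕ) := by omega
  have hi' : (i' : ℕ) < m := by omega
  have e : i' = i := part_injOn L hi' hi (by omega)
  subst e
  have hyj : L.part j' = L.part j := by omega
  refine ⟨rfl, hj', hyj, ?_⟩
  have h3 : lowerSeq L.part i' j' l' i' = lowerSeq L.part i' j l i' :=
    (or_of_balance_right (hb (lowerSeq L.part i' j l i')) (Or.inl ⟨hi, rfl⟩) (by omega)
      (by omega)).elim And.right fun h => absurd h.1 hj'.not_gt
  omega

/-- As for two fermionic positions, but bosonic parts may repeat, so the positions are determined
only through their values. -/
theorem eq_of_isBar_lowerSeq_symm {L Om : Superpartition N m} {i j i' j' : Fin N} {l l' : ℕ}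
    {σa σs σa' σs' : Equiv.Perm (Fin N)} (hij : i < j) (hij' : i' < j')
    (h0 : 0 < l) (hl : l < gap L.part i j) (h0' : 0 < l') (hl' : l' < gap L.part i' j')
    (h : IsBar (lowerSeq L.part i j l) Om σa σs) (h' : IsBar (lowerSeq L.part i' j' l') Om σa' σs')
    (hi : m ≤ (i : ℕ)) :
    m ≤ (i' : ℕ) ∧ L.part i' = L.part i ∧ L.part j' = L.part j ∧
      (l' = l ∨ l' = gap L.part i j - l) := by
  have hb := lowerSeq_balance_antisymm hij.ne hij'.ne h h'
  have hb' := lowerSeq_balance_symm hij.ne hij'.ne h h'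
  have hv := lowerSeq_values hij.ne h0 hl
  have hv' := lowerSeq_values hij'.ne h0' hl'
  have hlt : (i' : ℕ) < j' := hij'
  have hlt' : (i : ℕ) < j := hij
  have hle := part_le_of_not_mixed L hij (Or.inr hi)
  have hi' : m ≤ (i' : ℕ) := by
    by_contra hc
    have := or_of_balance_left (hb (L.part i')).symm (Or.inl ⟨not_le.mp hc, rfl⟩) (by omega)
      (by omega)
    omega
  have hle' := part_le_of_not_mixed L hij' (Or.inr hi')
  have hx : L.part i' = L.part i ∨ L.part j' = L.part i :=
    (or_of_balance_left (hb' (L.part i)) (Or.inl ⟨hi.not_gt, rfl⟩) (by omega) (by omega)).imp And.right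
      And.right
  have hy : L.part i' = L.part j ∨ L.part j' = L.part j :=
    (or_of_balance_left (hb' (L.part j)) (Or.inr ⟨by omega, rfl⟩) (by omega) (by omega)).imp And.right
      And.right
  have h3 : lowerSeq L.part i' j' l' i' = lowerSeq L.part i j l i ∨
      lowerSeq L.part i' j' l' j' = lowerSeq L.part i j l i :=
    (or_of_balance_right (hb' (lowerSeq L.part i j l i)) (Or.inl ⟨hi.not_gt, rfl⟩) (by omega)
      (by omega)).imp And.right And.right
  unfold gap
  omega

/-! ### Symmetries of lowered sequences -/

/-- Moving the complementary amount carries the larger entry past the smaller one and yields the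
same two values in exchanged places. -/
theorem lowerSeq_gap_sub (γ : Fin N → ℕ) {i j : Fin N} (hij : i ≠ j) {l : ℕ}
    (hl : l ≤ gap γ i j) :
    lowerSeq γ i j (gap γ i j - l) = lowerSeq γ i j l ∘ Equiv.swap i j := by
  funext x
  unfold gap at *
  rw [Function.comp_apply]
  rcases eq_or_ne x i with rfl | hi
  · rw [Equiv.swap_apply_left, lowerSeq_left γ hij, lowerSeq_right]
    split_ifs <;> omega
  rcases eq_or_ne x j with rfl | hj
  · rw [Equiv.swap_apply_right, lowerSeq_left γ hij, lowerSeq_right]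
    split_ifs <;> omega
  · rw [Equiv.swap_apply_of_ne_of_ne hi hj, lowerSeq_of_ne γ hi hj, lowerSeq_of_ne γ hi hj]

theorem comp_swap_eq_self {γ : Fin N → ℕ} {p q : Fin N} (h : γ p = γ q) (x : Fin N) :
    γ (Equiv.swap p q x) = γ x := by
  rcases eq_or_ne x p with rfl | hp
  · rw [Equiv.swap_apply_left, h]
  rcases eq_or_ne x q with rfl | hq
  · rw [Equiv.swap_apply_right, h]
  · rw [Equiv.swap_apply_of_ne_of_ne hp hq]

theorem lowerSeq_comp_swap {γ : Fin N → ℕ} {p q : Fin N} (h : γ p = γ q) {i j : Fin N}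
    (hij : i ≠ j) (l : ℕ) :
    lowerSeq γ (Equiv.swap p q i) (Equiv.swap p q j) l = lowerSeq γ i j l ∘ Equiv.swap p q := by
  set τ := Equiv.swap p q with hτ
  have hγ : ∀ x, γ (τ x) = γ x := comp_swap_eq_self h
  have hinv : ∀ x, τ (τ x) = x := Equiv.swap_apply_self p q
  have hne : τ i ≠ τ j := fun e => hij (τ.injective e)
  funext x
  obtain ⟨y, rfl⟩ := τ.surjective x
  rw [Function.comp_apply, hinv]
  rcases eq_or_ne y i with rfl | hi
  · rw [lowerSeq_left γ hne, lowerSeq_left γ hij, hγ, hγ]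
  rcases eq_or_ne y j with rfl | hj
  · rw [lowerSeq_right, lowerSeq_right, hγ, hγ]
  · rw [lowerSeq_of_ne γ (fun e => hi (τ.injective e)) (fun e => hj (τ.injective e)),
      lowerSeq_of_ne γ hi hj, hγ]

/-! ### Multiplicities and symmetry factors of lowered sequences -/

theorem seqMult_eq_sum (γ : Fin N → ℕ) (a : ℕ) :
    seqMult m γ a = ∑ x : Fin N, if m ≤ (x : ℕ) ∧ γ x = a then 1 else 0 :=
  Finset.card_filter _ _

theorem seqMult_update_of_le (γ : Fin N → ℕ) {j : Fin N} (hj : m ≤ (j : ℕ)) (a b : ℕ) :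
    seqMult m (Function.update γ j b) a + (if γ j = a then 1 else 0) =
      seqMult m γ a + (if b = a then 1 else 0) := by
  have := sum_update (fun x v => if m ≤ (x : ℕ) ∧ v = a then 1 else 0) γ j b
  simpa only [← seqMult_eq_sum, hj, true_and] using this

theorem seqMult_update_of_lt (γ : Fin N → ℕ) {j : Fin N} (hj : (j : ℕ) < m) (a b : ℕ) :
    seqMult m (Function.update γ j b) a = seqMult m γ a := by
  have := sum_update (fun x v => if m ≤ (x : ℕ) ∧ v = a then 1 else 0) γ j b
  simpa only [← seqMult_eq_sum, hj.not_ge, false_and, if_false, add_zero] using this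

/-- Only the factorials at the old and the new value change, by n! = n (n − 1)!. The ratio is
cross-multiplied to stay in ℕ. -/
theorem seqFactor_update (γ : Fin N → ℕ) {j : Fin N} (hj : m ≤ (j : ℕ)) (b : ℕ) :
    seqFactor m (Function.update γ j b) * seqMult m γ (γ j) =
      seqFactor m γ * seqMult m (Function.update γ j b) b := by
  by_cases hb : b = γ j
  · subst hb; rw [Function.update_eq_self]
  set δ := Function.update γ j b with hδ
  set s := Finset.univ.image γ ∪ Finset.univ.image δ with hs
  rw [seqFactor_eq_prod_of_subset γ (s := s) Finset.subset_union_left,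
    seqFactor_eq_prod_of_subset δ (s := s) Finset.subset_union_right]
  have h1 : seqMult m γ (γ j) = ∏ a ∈ s, if a = γ j then seqMult m γ a else 1 := by
    rw [Finset.prod_ite_eq' s (γ j), if_pos]
    exact Finset.mem_union_left _ (Finset.mem_image_of_mem _ (Finset.mem_univ _))
  have h2 : seqMult m δ b = ∏ a ∈ s, if a = b then seqMult m δ a else 1 := by
    rw [Finset.prod_ite_eq' s b, if_pos]
    refine Finset.mem_union_right _ (Finset.mem_image.mpr ⟨j, Finset.mem_univ _, ?_⟩)
    rw [hδ, Function.update_self]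
  rw [h1, h2, ← Finset.prod_mul_distrib, ← Finset.prod_mul_distrib]
  refine Finset.prod_congr rfl fun a _ => ?_
  have h := seqMult_update_of_le γ hj a b
  rw [← hδ] at h
  by_cases ha : a = γ j
  · rw [if_pos ha, if_neg (by rintro rfl; exact hb ha)]
    rw [if_pos ha.symm, if_neg (by rintro rfl; exact hb ha)] at h
    rw [add_zero] at h
    rw [← h, Nat.factorial_succ, mul_one, mul_comm]
  · rw [if_neg ha]
    rw [if_neg (Ne.symm ha)] at h
    by_cases hab : a = b
    · rw [if_pos hab]
      rw [if_pos hab.symm, add_zero] at h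
      rw [h, Nat.factorial_succ, mul_one, mul_comm]
    · rw [if_neg hab]
      rw [if_neg (Ne.symm hab), add_zero, add_zero] at h
      rw [h]

end Counting

/-! ### Evaluation of the coefficients, the order, the eigenvalue and the triangular action. -/

section Coefficients

variable {k : Type*} [Field k] {N m : ℕ}

open Superpartition

/-! ### The coefficients of the triangular action -/

/-- The signed number of ways, weighted by `gap - l`, in which `Ω` is a lowering of `Λ`. -/
def weightedCount (k : Type*) [Field k] (L Om : Superpartition N m) : k :=
  ∑ p ∈ pairs N, ∑ l ∈ Finset.Ico 1 (gap L.part p.1 p.2),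
    ((gap L.part p.1 p.2 - l : ℕ) : k) * barSign k (lowerSeq L.part p.1 p.2 l) Om

/-- The coefficient of `m_Ω` in the action of the Hamiltonian on `m_Λ`. -/
def actionCoeff (β : k) (L Om : Superpartition N m) : k :=
  2 * β * ((L.normFactor : k)⁻¹ * Om.normFactor) * weightedCount k L Om

theorem mem_pairs {p : Fin N × Fin N} : p ∈ pairs N ↔ p.1 < p.2 := by simp [pairs]

theorem barSign_comp_swap_of_lt {L : Fin N → ℕ} {Om : Superpartition N m}
    {σa σs : Equiv.Perm (Fin N)} (h : IsBar L Om σa σs) {p q : Fin N} (hpq : p ≠ q)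
    (hp : (p : ℕ) < m) (hq : (q : ℕ) < m) :
    barSign k (L ∘ Equiv.swap p q) Om = -((Equiv.Perm.sign σa : ℤ) : k) := by
  rw [(h.comp_swap_of_lt hp hq).barSign_eq, Equiv.Perm.sign_mul, Equiv.Perm.sign_swap hpq]
  simp

/-- Only l and d − l contribute, with opposite signs: (d − l) − l. This is the origin of δ = 2 in
type I. -/
theorem sum_Ico_antisymm {d l : ℕ} (h0 : 0 < l) (hl : l < d) (hne : 2 * l ≠ d) (s : k) (f : ℕ → k)
    (hf : ∀ l', f l' ≠ 0 → 0 < l' → l' < d → l' = l ∨ l' = d - l) (h1 : f l = s)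
    (h2 : f (d - l) = -s) :
    ∑ l' ∈ Finset.Ico 1 d, ((d - l' : ℕ) : k) * f l' = ((d : k) - 2 * l) * s := by
  have hne' : l ≠ d - l := by omega
  have hsub : ({l, d - l} : Finset ℕ) ⊆ Finset.Ico 1 d := by
    intro x hx
    rw [Finset.mem_insert, Finset.mem_singleton] at hx
    rw [Finset.mem_Ico]
    omega
  rw [← Finset.sum_subset hsub, Finset.sum_pair hne', h1, h2, Nat.cast_sub hl.le,
    Nat.cast_sub (Nat.sub_le d l), Nat.cast_sub hl.le]
  · ring
  · intro x hx hx'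
    rw [Finset.mem_Ico] at hx
    rw [Finset.mem_insert, Finset.mem_singleton] at hx'
    by_cases hz : f x = 0
    · rw [hz, mul_zero]
    · exact absurd (hf x hz hx.1 hx.2) hx'

/-- The contributions of l and d − l add up to (d − l) + l = d, whence δ = 0 in type III. At the
midpoint they are one and the same term, of weight l = d/2. -/
theorem sum_Ico_symm {d l : ℕ} (h0 : 0 < l) (hl : l < d) (s : k) (f : ℕ → k)
    (hf : ∀ l', f l' ≠ 0 → 0 < l' → l' < d → l' = l ∨ l' = d - l) (h1 : f l = s)
    (h2 : f (d - l) = s) :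
    ∑ l' ∈ Finset.Ico 1 d, ((d - l' : ℕ) : k) * f l' = (if 2 * l = d then (l : k) else d) * s := by
  have hz : ∀ x ∈ Finset.Ico 1 d, x ∉ ({l, d - l} : Finset ℕ) →
      ((d - x : ℕ) : k) * f x = 0 := by
    intro x hx hx'
    rw [Finset.mem_Ico] at hx
    rw [Finset.mem_insert, Finset.mem_singleton] at hx'
    by_cases hz : f x = 0
    · rw [hz, mul_zero]
    · exact absurd (hf x hz hx.1 hx.2) hx'
  have hsub : ({l, d - l} : Finset ℕ) ⊆ Finset.Ico 1 d := by
    intro x hx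
    rw [Finset.mem_insert, Finset.mem_singleton] at hx
    rw [Finset.mem_Ico]
    omega
  rw [← Finset.sum_subset hsub hz]
  split_ifs with h
  · have e : d - l = l := by omega
    rw [e, Finset.pair_eq_singleton, Finset.sum_singleton, h1, e]
  · rw [Finset.sum_pair (by omega), h1, h2, Nat.cast_sub hl.le,
      Nat.cast_sub (Nat.sub_le d l), Nat.cast_sub hl.le]
    ring

theorem weightedCount_antisymm [CharZero k] {L Om : Superpartition N m} {i j : Fin N} {l : ℕ}
    {σa σs : Equiv.Perm (Fin N)} (hij : i < j) (h0 : 0 < l) (hl : l < gap L.part i j)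
    (h : IsBar (lowerSeq L.part i j l) Om σa σs) (hj : (j : ℕ) < m) :
    weightedCount k L Om =
      ((gap L.part i j : k) - 2 * l) * ((Equiv.Perm.sign σa : ℤ) : k) := by
  have hi : (i : ℕ) < m := lt_trans hij hj
  rw [weightedCount, Finset.sum_eq_single_of_mem (i, j) (mem_pairs.mpr hij)]
  · refine sum_Ico_antisymm h0 hl ?_ _ (fun l' => barSign k (lowerSeq L.part i j l') Om) ?_
      h.barSign_eq ?_
    -- At the midpoint two fermionic entries would be equal, and no superpartition could arise.
    · intro e
      have hv := lowerSeq_values hij.ne h0 hl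
      have hle := part_le_of_not_mixed L hij (Or.inl hj)
      unfold gap at e
      exact hij.ne (h.injOn hi hj (by omega))
    · intro l' hne h0' hl'
      obtain ⟨σa', σs', h'⟩ := exists_isBar_of_barSign_ne_zero hne
      exact (eq_of_isBar_lowerSeq_antisymm hij hij h0 hl h0' hl' h h' hj).2.2
    · rw [lowerSeq_gap_sub _ hij.ne hl.le]
      exact barSign_comp_swap_of_lt h hij.ne hi hj
  · intro p hp hne
    refine Finset.sum_eq_zero fun l' hl' => ?_
    rw [Finset.mem_Ico] at hl'
    by_contra hc
    obtain ⟨σa', σs', h'⟩ := exists_isBar_of_barSign_ne_zero (right_ne_zero_of_mul hc)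
    have := eq_of_isBar_lowerSeq_antisymm hij (mem_pairs.mp hp) h0 hl hl'.1 hl'.2 h h' hj
    exact hne (Prod.ext this.1 this.2.1)

theorem isBar_lowerSeq_right {L Om : Superpartition N m} {i j j' : Fin N} {l : ℕ}
    {σa σs : Equiv.Perm (Fin N)} (hij : i ≠ j) (hij' : i ≠ j')
    (h : IsBar (lowerSeq L.part i j l) Om σa σs) (hj : m ≤ (j : ℕ)) (hj' : m ≤ (j' : ℕ))
    (e : L.part j' = L.part j) :
    IsBar (lowerSeq L.part i j' l) Om σa (σs * Equiv.swap j j') := by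
  have := lowerSeq_comp_swap (p := j) (q := j') e.symm hij l
  rw [Equiv.swap_apply_left, Equiv.swap_apply_of_ne_of_ne hij hij'] at this
  rw [this]
  exact h.comp_swap_of_le hj hj'

theorem isBar_lowerSeq_left {L Om : Superpartition N m} {i j i' : Fin N} {l : ℕ}
    {σa σs : Equiv.Perm (Fin N)} (hij : i ≠ j) (hij' : i' ≠ j)
    (h : IsBar (lowerSeq L.part i j l) Om σa σs) (hi : m ≤ (i : ℕ)) (hi' : m ≤ (i' : ℕ))
    (e : L.part i' = L.part i) :
    IsBar (lowerSeq L.part i' j l) Om σa (σs * Equiv.swap i i') := by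
  have := lowerSeq_comp_swap (p := i) (q := i') e.symm hij l
  rw [Equiv.swap_apply_left, Equiv.swap_apply_of_ne_of_ne hij.symm hij'.symm] at this
  rw [this]
  exact h.comp_swap_of_le hi hi'

/-- The pair may be changed only by replacing j with a bosonic position of equal part, and each such
pair contributes the single amount l. -/
theorem weightedCount_mixed {L Om : Superpartition N m} {i j : Fin N} {l : ℕ}
    {σa σs : Equiv.Perm (Fin N)} (hij : i < j) (h0 : 0 < l) (hl : l < gap L.part i j)
    (h : IsBar (lowerSeq L.part i j l) Om σa σs) (hi : (i : ℕ) < m) (hj : m ≤ (j : ℕ)) :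
    weightedCount k L Om = (seqMult m L.part (L.part j) : k) *
      (((gap L.part i j : k) - l) * ((Equiv.Perm.sign σa : ℤ) : k)) := by
  have hinner : ∀ p ∈ pairs N, ∑ l' ∈ Finset.Ico 1 (gap L.part p.1 p.2),
      ((gap L.part p.1 p.2 - l' : ℕ) : k) * barSign k (lowerSeq L.part p.1 p.2 l') Om =
      if p.1 = i ∧ m ≤ (p.2 : ℕ) ∧ L.part p.2 = L.part j then
        ((gap L.part i j : k) - l) * ((Equiv.Perm.sign σa : ℤ) : k) else 0 := by
    rintro ⟨i', j'⟩ hp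
    rw [mem_pairs] at hp
    split_ifs with hc
    · obtain ⟨rfl, hj', e⟩ := hc
      have hg : gap L.part i' j' = gap L.part i' j := by
        simp only [gap]; rw [show L.part j' = L.part j from e]
      have hb := isBar_lowerSeq_right hij.ne (ne_of_lt hp) h hj hj' e
      simp only [hg]
      rw [Finset.sum_eq_single_of_mem l (Finset.mem_Ico.mpr ⟨h0, hl⟩)]
      · rw [hb.barSign_eq, Nat.cast_sub hl.le]
      · intro l' hl' hne
        rw [Finset.mem_Ico] at hl'
        by_contra hc
        obtain ⟨σa', σs', h'⟩ := exists_isBar_of_barSign_ne_zero (right_ne_zero_of_mul hc)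
        exact hne (eq_of_isBar_lowerSeq_mixed hij hp h0 hl hl'.1 (hg ▸ hl'.2) h h' hi hj).2.2.2
    · refine Finset.sum_eq_zero fun l' hl' => ?_
      rw [Finset.mem_Ico] at hl'
      by_contra hz
      obtain ⟨σa', σs', h'⟩ := exists_isBar_of_barSign_ne_zero (right_ne_zero_of_mul hz)
      have := eq_of_isBar_lowerSeq_mixed hij hp h0 hl hl'.1 hl'.2 h h' hi hj
      exact hc ⟨this.1, this.2.1, this.2.2.1⟩
  rw [weightedCount, Finset.sum_congr rfl hinner, ← Finset.sum_filter, Finset.sum_const,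
    nsmul_eq_mul]
  congr 2
  refine Finset.card_bij (fun p _ => p.2) ?_ ?_ ?_
  · intro p hp
    simp only [Finset.mem_filter, Finset.mem_univ, true_and] at hp ⊢
    exact hp.2.2
  · intro p hp q hq e
    simp only [Finset.mem_filter] at hp hq
    exact Prod.ext (hp.2.1.trans hq.2.1.symm) e
  · intro j' hj'
    simp only [Finset.mem_filter, Finset.mem_univ, true_and] at hj'
    refine ⟨(i, j'), Finset.mem_filter.mpr ⟨mem_pairs.mpr ?_, rfl, hj'⟩, rfl⟩
    exact lt_of_lt_of_le (b := (⟨m, hj'.1.trans_lt j'.2⟩ : Fin N)) hi hj'.1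

theorem weightedCount_symm {L Om : Superpartition N m} {i j : Fin N} {l : ℕ}
    {σa σs : Equiv.Perm (Fin N)} (hij : i < j) (h0 : 0 < l) (hl : l < gap L.part i j)
    (h : IsBar (lowerSeq L.part i j l) Om σa σs) (hi : m ≤ (i : ℕ)) :
    weightedCount k L Om = ((seqMult m L.part (L.part i) : k) * seqMult m L.part (L.part j)) *
      ((if 2 * l = gap L.part i j then (l : k) else gap L.part i j) *
        ((Equiv.Perm.sign σa : ℤ) : k)) := by
  have hj : m ≤ (j : ℕ) := hi.trans (le_of_lt hij)
  have hlt : L.part j < L.part i := by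
    have := part_le_of_not_mixed L hij (Or.inr hi)
    unfold gap at hl
    omega
  have hinner : ∀ p ∈ pairs N, ∑ l' ∈ Finset.Ico 1 (gap L.part p.1 p.2),
      ((gap L.part p.1 p.2 - l' : ℕ) : k) * barSign k (lowerSeq L.part p.1 p.2 l') Om =
      if m ≤ (p.1 : ℕ) ∧ L.part p.1 = L.part i ∧ L.part p.2 = L.part j then
        (if 2 * l = gap L.part i j then (l : k) else gap L.part i j) *
          ((Equiv.Perm.sign σa : ℤ) : k) else 0 := by
    rintro ⟨i', j'⟩ hp
    rw [mem_pairs] at hp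
    by_cases hc : m ≤ (i' : ℕ) ∧ L.part i' = L.part i ∧ L.part j' = L.part j
    · rw [if_pos hc]
      obtain ⟨hi', ei, ej⟩ := hc
      have hj' : m ≤ (j' : ℕ) := hi'.trans (le_of_lt hp)
      have hg : gap L.part i' j' = gap L.part i j := by simp only [gap, ei, ej]
      have hne : i' ≠ j := by rintro rfl; omega
      have hb := isBar_lowerSeq_right hne (ne_of_lt hp)
        (isBar_lowerSeq_left hij.ne hne h hi hi' ei) hj hj' ej
      simp only [hg]
      refine sum_Ico_symm h0 hl _ (fun l' => barSign k (lowerSeq L.part i' j' l') Om) ?_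
        hb.barSign_eq ?_
      · intro l' hz h0' hl'
        obtain ⟨σa', σs', h'⟩ := exists_isBar_of_barSign_ne_zero hz
        exact (eq_of_isBar_lowerSeq_symm hij hp h0 hl h0' (hg ▸ hl') h h' hi).2.2.2
      · rw [← hg, lowerSeq_gap_sub _ (ne_of_lt hp) (hg ▸ hl.le)]
        exact (hb.comp_swap_of_le hi' hj').barSign_eq
    · rw [if_neg hc]
      refine Finset.sum_eq_zero fun l' hl' => ?_
      rw [Finset.mem_Ico] at hl'
      by_contra hz
      obtain ⟨σa', σs', h'⟩ := exists_isBar_of_barSign_ne_zero (right_ne_zero_of_mul hz)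
      have := eq_of_isBar_lowerSeq_symm hij hp h0 hl hl'.1 hl'.2 h h' hi
      exact hc ⟨this.1, this.2.1, this.2.2.1⟩
  rw [weightedCount, Finset.sum_congr rfl hinner, ← Finset.sum_filter, Finset.sum_const,
    nsmul_eq_mul, ← Nat.cast_mul]
  congr 2
  rw [seqMult, seqMult, ← Finset.card_product]
  congr 1
  ext ⟨i', j'⟩
  simp only [Finset.mem_filter, Finset.mem_univ, true_and, Finset.mem_product, mem_pairs]
  constructor
  · rintro ⟨hp, hi', ei, ej⟩
    exact ⟨⟨hi', ei⟩, hi'.trans (le_of_lt hp), ej⟩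
  · rintro ⟨⟨hi', ei⟩, hj', ej⟩
    -- The order i' < j' is automatic, since the bosonic parts decrease weakly and Λ_j < Λ_i.
    refine ⟨?_, hi', ei, ej⟩
    by_contra hc
    have := L.symm_part j' i' hj' (not_lt.mp hc)
    omega

/-! ### Ratios of symmetry factors -/

theorem seqFactor_lowerSeq_antisymm (γ : Fin N → ℕ) {i j : Fin N} (hij : i < j) (l : ℕ)
    (hj : (j : ℕ) < m) : seqFactor m (lowerSeq γ i j l) = seqFactor m γ := by
  refine seqFactor_congr fun a => ?_
  rw [lowerSeq_eq_update γ hij.ne, seqMult_update_of_lt _ hj,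
    seqMult_update_of_lt _ (lt_trans hij hj)]

theorem seqFactor_lowerSeq_mixed (γ : Fin N → ℕ) {i j : Fin N} (hij : i < j) (l : ℕ)
    (hi : (i : ℕ) < m) (hj : m ≤ (j : ℕ)) :
    seqFactor m (lowerSeq γ i j l) * seqMult m γ (γ j) =
      seqFactor m γ * seqMult m (lowerSeq γ i j l) (lowerSeq γ i j l j) := by
  have h := seqFactor_update (Function.update γ i (lowerSeq γ i j l i)) hj (lowerSeq γ i j l j)
  rw [← lowerSeq_eq_update γ hij.ne, Function.update_of_ne hij.ne', seqMult_update_of_lt _ hi,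
    seqFactor_congr fun a => seqMult_update_of_lt γ hi a _] at h
  exact h

theorem seqFactor_lowerSeq_symm (γ : Fin N → ℕ) {i j : Fin N} (hij : i < j) {l : ℕ}
    (h0 : 0 < l) (hl : l < gap γ i j) (hi : m ≤ (i : ℕ)) :
    seqFactor m (lowerSeq γ i j l) * (seqMult m γ (γ i) * seqMult m γ (γ j)) =
      seqFactor m γ * (seqMult m (lowerSeq γ i j l) (lowerSeq γ i j l j) *
        (seqMult m (lowerSeq γ i j l) (lowerSeq γ i j l i) -
          if lowerSeq γ i j l i = lowerSeq γ i j l j then 1 else 0)) := by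
  have hj : m ≤ (j : ℕ) := hi.trans (le_of_lt hij)
  have hv := lowerSeq_values hij.ne h0 hl
  have h1 := seqFactor_update γ hi (lowerSeq γ i j l i)
  have h2 := seqFactor_update (Function.update γ i (lowerSeq γ i j l i)) hj (lowerSeq γ i j l j)
  have h3 := seqMult_update_of_le γ hi (γ j) (lowerSeq γ i j l i)
  have h4 := seqMult_update_of_le (Function.update γ i (lowerSeq γ i j l i)) hj
    (lowerSeq γ i j l i) (lowerSeq γ i j l j)
  rw [← lowerSeq_eq_update γ hij.ne, Function.update_of_ne hij.ne'] at h2 h4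
  rw [if_neg (by omega), if_neg (by omega), add_zero, add_zero] at h3
  rw [if_neg (by omega), add_zero] at h4
  rw [h3] at h2
  -- The intermediate sequence, with only entry i changed, lacks the new entry at j; when both new
  -- entries agree this accounts for n − 1 in n(n − 1).
  have h5 : seqMult m (Function.update γ i (lowerSeq γ i j l i)) (lowerSeq γ i j l i) =
      seqMult m (lowerSeq γ i j l) (lowerSeq γ i j l i) -
        if lowerSeq γ i j l i = lowerSeq γ i j l j then 1 else 0 := by
    rw [h4]
    simp only [eq_comm, Nat.add_sub_cancel]
  rw [← h5]
  calc _ = seqFactor m (lowerSeq γ i j l) * seqMult m γ (γ j) * seqMult m γ (γ i) := by ring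
    _ = seqFactor m (Function.update γ i (lowerSeq γ i j l i)) * seqMult m γ (γ i) *
          seqMult m (lowerSeq γ i j l) (lowerSeq γ i j l j) := by rw [h2]; ring
    _ = _ := by rw [h1]; ring

/-! ### Admissible lowerings -/

theorem gap_cast (γ : Fin N → ℕ) (i j : Fin N) : (gap γ i j : ℤ) = |(γ i : ℤ) - γ j| := by
  unfold gap
  rcases le_total (γ i) (γ j) with h | h
  · rw [abs_of_nonpos (by omega)]; omega
  · rw [abs_of_nonneg (by omega)]; omega

theorem Superpartition.Admissible.le_gap {L : Superpartition N m} {i j : Fin N} {l : ℕ}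
    (h : L.Admissible i j l) : l ≤ gap L.part i j := by
  have h1 := gap_cast L.part i j
  have h2 : gap L.part i j = (L.part i - L.part j) + (L.part j - L.part i) := rfl
  rcases h with ⟨_, h | h | h⟩ <;> omega

theorem Superpartition.Admissible.lt_gap {L : Superpartition N m} {i j : Fin N} {l : ℕ}
    (h : L.Admissible i j l) (h0 : 0 < l) : l < gap L.part i j := by
  have h1 := gap_cast L.part i j
  have h2 : gap L.part i j = (L.part i - L.part j) + (L.part j - L.part i) := rfl
  rcases h with ⟨_, h | h | h⟩ <;> omega

/-- Every rearranged lowering by an amount smaller than the gap is an admissible one. -/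
theorem exists_isLowering {L Om : Superpartition N m} {i j : Fin N} {l : ℕ}
    {σa σs : Equiv.Perm (Fin N)} (hij : i < j) (h0 : 0 < l) (hl : l < gap L.part i j)
    (h : IsBar (lowerSeq L.part i j l) Om σa σs) :
    ∃ i j l, 0 < l ∧ L.IsLowering i j l Om := by
  have hij' : (i : ℕ) < j := hij
  have hv := lowerSeq_values hij.ne h0 hl
  have hg : gap L.part i j = (L.part i - L.part j) + (L.part j - L.part i) := rfl
  have hga := gap_cast L.part i j
  rcases lt_or_ge (j : ℕ) m with hj | hj
  · have hle := part_le_of_not_mixed L hij (Or.inl hj)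
    have hi : (i : ℕ) < m := hij'.trans hj
    -- The midpoint would give two equal fermionic entries. Beyond it, the complementary amount is
    -- admissible and has the same rearrangement.
    have hne : 2 * l ≠ gap L.part i j := fun e => hij.ne (h.injOn hi hj (by omega))
    rcases lt_or_gt_of_ne hne with hlt | hgt
    · exact ⟨i, j, l, h0, ⟨hij, Or.inl ⟨hj, by omega⟩⟩, σa, σs, h⟩
    · refine ⟨i, j, gap L.part i j - l, by omega, ⟨hij, Or.inl ⟨hj, by omega⟩⟩,
        σa * Equiv.swap i j, σs, ?_⟩
      change IsBar (lowerSeq L.part i j _) _ _ _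
      rw [lowerSeq_gap_sub L.part hij.ne hl.le]
      exact h.comp_swap_of_lt hi hj
  rcases lt_or_ge (i : ℕ) m with hi | hi
  · exact ⟨i, j, l, h0, ⟨hij, Or.inr (Or.inl ⟨hi, hj, by omega⟩)⟩, σa, σs, h⟩
  · have hle := part_le_of_not_mixed L hij (Or.inr hi)
    rcases le_or_gt (2 * l) (gap L.part i j) with hlt | hgt
    · exact ⟨i, j, l, h0, ⟨hij, Or.inr (Or.inr ⟨hi, by omega⟩)⟩, σa, σs, h⟩
    · refine ⟨i, j, gap L.part i j - l, by omega, ⟨hij, Or.inr (Or.inr ⟨hi, by omega⟩)⟩,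
        σa, σs * Equiv.swap i j, ?_⟩
      change IsBar (lowerSeq L.part i j _) _ _ _
      rw [lowerSeq_gap_sub L.part hij.ne hl.le]
      exact h.comp_swap_of_le hi hj

theorem exists_isLowering_of_actionCoeff_ne_zero {β : k} {L Om : Superpartition N m}
    (h : actionCoeff β L Om ≠ 0) : ∃ i j l, 0 < l ∧ L.IsLowering i j l Om := by
  obtain ⟨p, hp, h1⟩ := Finset.exists_ne_zero_of_sum_ne_zero (right_ne_zero_of_mul h)
  obtain ⟨l, hl, h2⟩ := Finset.exists_ne_zero_of_sum_ne_zero h1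
  obtain ⟨σa, σs, hb⟩ := exists_isBar_of_barSign_ne_zero (right_ne_zero_of_mul h2)
  rw [Finset.mem_Ico] at hl
  exact exists_isLowering (mem_pairs.mp hp) hl.1 hl.2 hb

theorem coeff_eq (β : k) {L Om : Superpartition N m} {i j : Fin N} (hij : i ≠ j) {l : ℕ}
    (σa : Equiv.Perm (Fin N)) :
    Superpartition.coeff β L Om i j l σa =
      2 * β * ((Equiv.Perm.sign σa : ℤ) : k) * ((gap L.part i j : k) - (delta m i j : k) * l) *
        symmFactor k Om i j (lowerSeq L.part i j l i) (lowerSeq L.part i j l j) := by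
  rw [Superpartition.coeff, lowerSeq_left _ hij, lowerSeq_right]
  split_ifs with h
  · have : gap L.part i j = L.part i - L.part j := by unfold gap; omega
    rw [this, Nat.cast_sub h.le]
  · have : gap L.part i j = L.part j - L.part i := by unfold gap; omega
    rw [this, Nat.cast_sub (not_lt.mp h)]

/-- The weighted count involves multiplicities in Λ; the ratio of the normalising factors f_Ω/f_Λ
converts them into multiplicities in Ω. -/
theorem actionCoeff_eq_coeff [CharZero k] (β : k) {L Om : Superpartition N m} {i j : Fin N}
    {l : ℕ} {σa σs : Equiv.Perm (Fin N)} (h0 : 0 < l) (ha : L.Admissible i j l)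
    (h : IsBar (lowerSeq L.part i j l) Om σa σs) :
    actionCoeff β L Om = Superpartition.coeff β L Om i j l σa := by
  have hij : i < j := ha.1
  have hl := ha.lt_gap h0
  have hL : (L.normFactor : k) ≠ 0 := Nat.cast_ne_zero.mpr (seqFactor_ne_zero (m := m) L.part)
  have hLf : L.normFactor = seqFactor m L.part := rfl
  have hO := h.normFactor_eq
  have hv := lowerSeq_values hij.ne h0 hl
  have hg : gap L.part i j = (L.part i - L.part j) + (L.part j - L.part i) := rfl
  rw [coeff_eq β hij.ne, actionCoeff, symmFactor, delta, h.symmMult_eq, h.symmMult_eq]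
  rcases lt_or_ge (j : ℕ) m with hj | hj
  · rw [weightedCount_antisymm hij h0 hl h hj, if_pos hj, if_pos hj, hO,
      seqFactor_lowerSeq_antisymm _ hij l hj, ← hLf, inv_mul_cancel₀ hL]
    push_cast
    ring
  rw [if_neg hj.not_gt, if_neg hj.not_gt]
  rcases lt_or_ge (i : ℕ) m with hi | hi
  · have hF := congrArg (Nat.cast (R := k)) (seqFactor_lowerSeq_mixed L.part hij l hi hj)
    rw [← hO, ← hLf] at hF
    push_cast at hF
    rw [weightedCount_mixed hij h0 hl h hi hj, if_pos hi, if_pos hi, Nat.cast_one, one_mul]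
    rw [mul_comm (Nat.cast (R := k) L.normFactor)] at hF
    have hF' := (eq_mul_inv_iff_mul_eq₀ hL).mpr hF.symm
    linear_combination (-2 * β * ((gap L.part i j : k) - l) *
      ((Equiv.Perm.sign σa : ℤ) : k)) * hF'
  · have hle := part_le_of_not_mixed L hij (Or.inr hi)
    have hF := congrArg (Nat.cast (R := k)) (seqFactor_lowerSeq_symm L.part hij h0 hl hi)
    rw [← hO, ← hLf, Nat.cast_mul, Nat.cast_mul, Nat.cast_mul, Nat.cast_mul,
      mul_comm (Nat.cast (R := k) L.normFactor)] at hF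
    have hF' := (eq_mul_inv_iff_mul_eq₀ hL).mpr hF.symm
    rw [weightedCount_symm hij h0 hl h hi, if_neg hi.not_gt, if_neg hi.not_gt]
    -- The new entries agree exactly at the midpoint 2l = gap, where the weight l is half the gap
    -- and produces the factor 1/2.
    by_cases hab : lowerSeq L.part i j l i = lowerSeq L.part i j l j
    · rw [if_neg (not_not.mpr hab), if_pos (by omega)]
      have hpos : 1 ≤ seqMult m (lowerSeq L.part i j l) (lowerSeq L.part i j l i) :=
        Finset.card_pos.mpr ⟨i, Finset.mem_filter.mpr ⟨Finset.mem_univ _, hi, rfl⟩⟩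
      rw [if_pos hab, Nat.cast_sub hpos, ← hab] at hF'
      have hgl : (gap L.part i j : k) = 2 * l := by
        rw [show gap L.part i j = 2 * l by omega]; push_cast; ring
      rw [hgl]
      linear_combination (-2 * β * l * ((Equiv.Perm.sign σa : ℤ) : k)) * hF'
    · rw [if_pos hab, if_neg (by omega)]
      rw [if_neg hab, Nat.sub_zero] at hF'
      linear_combination (-2 * β * (gap L.part i j : k) * ((Equiv.Perm.sign σa : ℤ) : k)) * hF'

/-! ### The order -/

theorem Superpartition.IsBar.sum_part {γ : Fin N → ℕ} {Om : Superpartition N m}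
    {σa σs : Equiv.Perm (Fin N)} (h : IsBar γ Om σa σs) : ∑ x, γ x = ∑ x, Om.part x :=
  h.sum_eq (fun _ v => v) fun _ _ _ => rfl

theorem Superpartition.IsLowering.sum_part {L Om : Superpartition N m} {i j : Fin N} {l : ℕ}
    (h : L.IsLowering i j l Om) : ∑ x, Om.part x = ∑ x, L.part x := by
  obtain ⟨ha, σa, σs, hb⟩ := h
  have hl := ha.le_gap
  unfold gap at hl
  have hs := sum_lowerSeq (fun _ v => v) L.part ha.1.ne l
  rw [lowerSeq_left _ ha.1.ne, lowerSeq_right] at hs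
  rw [← hb.sum_part]
  change ∑ x, lowerSeq L.part i j l x = _
  split_ifs at hs <;> omega

/-- The sum of squares is invariant under rearrangement and drops strictly when 0 < l < gap. -/
theorem Superpartition.IsLowering.ne {L Om : Superpartition N m} {i j : Fin N} {l : ℕ}
    (h : L.IsLowering i j l Om) (h0 : 0 < l) : Om ≠ L := by
  rintro rfl
  obtain ⟨ha, σa, σs, hb⟩ := h
  have hb' : IsBar (lowerSeq Om.part i j l) Om σa σs := hb
  have hv := lowerSeq_values ha.1.ne h0 (ha.lt_gap h0)
  have hs := sum_lowerSeq (fun _ v => v ^ 2) Om.part ha.1.ne l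
  rw [hb'.sum_eq (fun _ v => v ^ 2) fun _ _ _ => rfl] at hs
  rcases hv with ⟨h1, h2, h3, h4⟩ | ⟨h1, h2, h3, h4⟩
  · rw [h2, h3] at hs
    obtain ⟨e, he⟩ := Nat.exists_eq_add_of_lt h4
    have : Om.part i = Om.part j + l + e + 1 := by omega
    rw [this, show Om.part j + l + e + 1 - l = Om.part j + e + 1 by omega] at hs
    nlinarith
  · rw [h2, h3] at hs
    obtain ⟨e, he⟩ := Nat.exists_eq_add_of_lt h4
    have : Om.part j = Om.part i + l + e + 1 := by omega
    rw [this, show Om.part i + l + e + 1 - l = Om.part i + e + 1 by omega] at hs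
    nlinarith

theorem Superpartition.IsLowering.ltS {L Om : Superpartition N m} {i j : Fin N} {l : ℕ}
    (h : L.IsLowering i j l Om) (h0 : 0 < l) : LtS Om L :=
  ⟨Relation.ReflTransGen.single ⟨i, j, l, h⟩, h.ne h0⟩

theorem Superpartition.LeS.sum_part {L Om : Superpartition N m} (h : LeS Om L) :
    ∑ x, Om.part x = ∑ x, L.part x := by
  induction h with
  | refl => rfl
  | tail _ h ih =>
    obtain ⟨i, j, l, h⟩ := h
    exact h.sum_part.trans ih

/-- The operations preserve the sum of the parts, which bounds every single part. -/
theorem finite_ltS (L : Superpartition N m) : {Om : Superpartition N m | LtS Om L}.Finite := by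
  refine ((Set.finite_Iic fun _ : Fin N => ∑ x, L.part x).preimage
    (f := Superpartition.part (N := N) (m := m)) fun A _ B _ e => Superpartition.ext e).subset ?_
  intro Om h i
  rw [← h.1.sum_part]
  exact Finset.single_le_sum (f := Om.part) (fun _ _ => Nat.zero_le _) (Finset.mem_univ i)

/-! ### The eigenvalue -/

theorem star_antitone (L : Superpartition N m) : Antitone L.star := fun _ _ h =>
  Tuple.monotone_sort L.part (Fin.rev_le_rev.mpr h)

/-- Counting from 0, the index j is the first member of N − 1 − j pairs and the second of j pairs;
the difference N − 1 − 2j equals N + 1 − 2(j + 1). -/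
theorem sum_pairs_sub (f : Fin N → k) :
    ∑ p ∈ pairs N, (f p.1 - f p.2) = ∑ j : Fin N, ((N : k) + 1 - 2 * ((j : ℕ) + 1 : k)) * f j := by
  have h1 : ∑ p ∈ pairs N, f p.1 = ∑ j : Fin N, ((N : k) - 1 - (j : ℕ)) * f j := by
    rw [pairs, Finset.sum_filter, Fintype.sum_prod_type]
    refine Finset.sum_congr rfl fun i _ => ?_
    dsimp only
    rw [← Finset.sum_filter, Finset.sum_const, nsmul_eq_mul]
    have : (Finset.univ.filter fun x => i < x) = Finset.Ioi i := by ext; simp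
    rw [this, Fin.card_Ioi, Nat.sub_sub, Nat.cast_sub (by omega)]
    push_cast
    ring
  have h2 : ∑ p ∈ pairs N, f p.2 = ∑ j : Fin N, ((j : ℕ) : k) * f j := by
    rw [pairs, Finset.sum_filter, Fintype.sum_prod_type, Finset.sum_comm]
    refine Finset.sum_congr rfl fun i _ => ?_
    dsimp only
    rw [← Finset.sum_filter, Finset.sum_const, nsmul_eq_mul]
    have : (Finset.univ.filter fun x => x < i) = Finset.Iio i := by ext; simp
    rw [this, Fin.card_Iio]
  rw [Finset.sum_sub_distrib, h1, h2, ← Finset.sum_sub_distrib]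
  exact Finset.sum_congr rfl fun j _ => by ring

/-- Both sums on the right are invariant under permutation of the parts, and on the decreasing
rearrangement each gap is a plain difference. -/
theorem eigenvalue_eq (β : k) (L : Superpartition N m) :
    L.eigenvalue β =
      ∑ i, (L.part i : k) ^ 2 + β * ∑ p ∈ pairs N, (gap L.part p.1 p.2 : k) := by
  set π : Equiv.Perm (Fin N) := Tuple.sort L.part * Fin.revPerm with hπ
  have hstar : ∀ j, L.star j = L.part (π j) := fun j => rfl
  have h1 : ∑ i, (L.part i : k) ^ 2 = ∑ i, (L.star i : k) ^ 2 :=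
    (Equiv.sum_comp π fun i => (L.part i : k) ^ 2).symm
  have h2 : ∑ p ∈ pairs N, (gap L.part p.1 p.2 : k) =
      ∑ p ∈ pairs N, ((L.star p.1 : k) - L.star p.2) := by
    rw [← sum_pairs_perm (fun p q => (gap L.part p q : k)) (fun p q => by rw [gap_comm]) π]
    refine Finset.sum_congr rfl fun p hp => ?_
    have hle := star_antitone L (mem_pairs.mp hp).le
    rw [← Nat.cast_sub hle, hstar, hstar]
    rw [hstar, hstar] at hle
    rw [gap, Nat.sub_eq_zero_of_le hle, add_zero]
  rw [h1, h2, sum_pairs_sub fun j => (L.star j : k), Superpartition.eigenvalue,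
    Finset.sum_add_distrib, Finset.mul_sum]
  simp only [mul_assoc]

/-! ### The triangular action -/

theorem sum_smul_sum_smul_comm {M ι κ : Type*} [AddCommGroup M] [Module k M] (s : Finset ι)
    (t : ι → Finset ℕ) (S : Finset κ) (c : k) (w : ι → ℕ → k) (b : ι → ℕ → κ → k) (f : κ → k)
    (x : κ → M) :
    c • ∑ p ∈ s, ∑ l ∈ t p, w p l • ∑ o ∈ S, (b p l o * f o) • x o =
      ∑ o ∈ S, (c * f o * ∑ p ∈ s, ∑ l ∈ t p, w p l * b p l o) • x o := by
  simp only [Finset.smul_sum, Finset.mul_sum, Finset.sum_smul, smul_smul]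
  symm
  rw [Finset.sum_comm]
  refine Finset.sum_congr rfl fun p _ => ?_
  rw [Finset.sum_comm]
  refine Finset.sum_congr rfl fun l _ => Finset.sum_congr rfl fun o _ => ?_
  congr 1
  ring

theorem hamiltonian_monomial [CharZero k] (β : k) (L : Superpartition N m)
    (S : Finset (Superpartition N m)) (hS : ∀ Om, LtS Om L → Om ∈ S) :
    hamiltonian β (L.monomial k) =
      L.eigenvalue β • L.monomial k + ∑ Om ∈ S, actionCoeff β L Om • Om.monomial k := by
  have hmon : L.monomial k = (L.normFactor : k)⁻¹ • orbitSum k L.m_le L.part := rfl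
  have hexp : ∀ p ∈ pairs N, ∀ l ∈ Finset.Ico 1 (gap L.part p.1 p.2),
      orbitSum k L.m_le (lowerSeq L.part p.1 p.2 l) =
        ∑ Om ∈ S, (barSign k (lowerSeq L.part p.1 p.2 l) Om * (Om.normFactor : k)) •
          Om.monomial k := by
    intro p hp l hl
    rw [Finset.mem_Ico] at hl
    -- The set S suffices, since every rearrangement that occurs is an admissible lowering with l >
    -- 0 and hence strictly below Λ.
    refine orbitSum_eq_sum _ _ _ fun Om σa σs h => hS Om ?_
    obtain ⟨i, j, l', h0, h'⟩ := exists_isLowering (mem_pairs.mp hp) hl.1 hl.2 h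
    exact h'.ltS h0
  have hsum := (congrArg ((2 * β) • ·) (Finset.sum_congr rfl fun p hp =>
    Finset.sum_congr rfl fun l hl =>
      congrArg (((gap L.part p.1 p.2 - l : ℕ) : k) • ·) (hexp p hp l hl))).trans
    (sum_smul_sum_smul_comm (pairs N) (fun p => Finset.Ico 1 (gap L.part p.1 p.2)) S (2 * β)
      (fun p l => ((gap L.part p.1 p.2 - l : ℕ) : k))
      (fun p l Om => barSign k (lowerSeq L.part p.1 p.2 l) Om)
      (fun Om => (Om.normFactor : k)) fun Om => Om.monomial k)
  rw [hmon, map_smul, hamiltonian_orbitSum, smul_add, smul_comm, ← eigenvalue_eq]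
  refine congrArg (_ + ·) ((congrArg ((L.normFactor : k)⁻¹ • ·) hsum).trans ?_)
  rw [Finset.smul_sum]
  refine Finset.sum_congr rfl fun Om _ => ?_
  rw [smul_smul, actionCoeff, weightedCount]
  congr 1
  ring

end Coefficients

end

end SuperCMS

/-- Triangularity of the supersymmetric Calogero–Moser–Sutherland Hamiltonian on supermonomials. -/
theorem corollary6 {k : Type*} [Field k] [CharZero k] (β : k) (N m : ℕ) :
    ∃ v : Superpartition N m → Superpartition N m → k,
      -- the explicit value of the coefficients
      (∀ (L Om : Superpartition N m) (i j : Fin N) (l : ℕ) (σa σs : Equiv.Perm (Fin N)),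
        0 < l → L.Admissible i j l → Superpartition.IsBar (L.lower i j l) Om σa σs →
          v L Om = Superpartition.coeff β L Om i j l σa) ∧
      (∀ L Om : Superpartition N m, v L Om ≠ 0 → ∃ i j l, 0 < l ∧ L.IsLowering i j l Om) ∧
      -- the triangular action
      ∀ L : Superpartition N m, ∃ hfin : {Om : Superpartition N m | Superpartition.LtS Om L}.Finite,
        hamiltonian β (L.monomial k) =
          L.eigenvalue β • L.monomial k + ∑ Om ∈ hfin.toFinset, v L Om • Om.monomial k :=
  ⟨actionCoeff β, fun _ _ _ _ _ _ _ h0 ha h => actionCoeff_eq_coeff β h0 ha h,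
    fun _ _ h => exists_isLowering_of_actionCoeff_ne_zero h,
    fun L => ⟨finite_ltS L, hamiltonian_monomial β L _ fun _ h => (finite_ltS L).mem_toFinset.mpr h⟩⟩
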